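/- Let $n\ge 2$, $\alpha=e^{2\pi i/n}$, $a=\mathrm{diag}(1,\alpha,\dots,\alpha^{n-1})$, and let $\tau$ be the permutation matrix with $\tau e_i=e_{i+1}$ (indices mod $n$). Put $\mathcal G_0=\{y\in gl(n,\mathbb C):\tau^{-1}y\tau=y\}$, $sl(n)_a=\{y\in sl(n,\mathbb C):[a,y]=0\}$, and let $sl(n)_a^\perp$ be the orthogonal complement of $sl(n)_a$ in $sl(n,\mathbb C)$ with respect to the form $\mathrm{tr}(xy)$. For a smooth matrix function $u(x,t)$ with values in $sl(n)_a^\perp$, let $Q_{a,j}(u)$ be the polynomial differential operators (in $x$) of the $sl(n,\mathbb C)$-hierarchy: $Q_{a,0}=a$, the off-diagonal part of $Q_{a,j+1}(u)$ is determined by $(Q_{a,j}(u))_x+[u,Q_{a,j}(u)]=[Q_{a,j+1}(u),a]$, and its diagonal part by the coefficient of $\lambda^{-(j+1)}$ in $\bigl(a+\sum_{i\ge1}Q_{a,i}(u)\lambda^{-i}\bigr)^n=I$. For an open set $\mathcal O\subset\mathbb R^2$, a solution of the Kupershmidt–Wilson (KW) equation on $\mathcal O$ is a smooth map $u:\mathcal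 O\to\mathcal G_0\cap sl(n)_a^\perp$ with $$u_t=(Q_{a,n+1}(u))_x+[u,Q_{a,n+1}(u)].$$ If $(0,0)\in\mathcal O$, a trivialization of $u$ normalized at $(0,0)$ is a map $E(x,t,\lambda)$, $(x,t)\in\mathcal O$, $\lambda\in\mathbb C$, smooth in $(x,t)$, such that for all $\lambda\in\mathbb C$ $$E_x=E(a\lambda+u),\qquad E_t=E\sum_{j=0}^{n+1}Q_{a,j}(u)\lambda^{n+1-j},\qquad E(0,0,\lambda)=I.$$ For $w\in\mathbb C^n$ let $B(w)$ be the $n\times n$ matrix with columns $w,\tau^{-1}w,\dots,\tau^{-(n-1)}w$, and, if $B(w)$ is nonsingular, put $p_{w,k}(\lambda)=a\lambda-kaB(w)aB(w)^{-1}$. **Theorem.** Let $\mathcal O_1\subset\mathbb R^2$ be a connected open set containing $(0,0)$, $u$ a solution of the KW equation on $\mathcal O_1$, $E$ a trivialization of $u$ on $\mathcal O_1$ normalized at $(0,0)$, $v\in\mathbb C^n$ with $B(v)$ nonsingular, and $k\in\mathbb C$, $k\ne0$. Then $E(x,t,k)$ is invertible for every $(x,t)\in\mathcal O_1$. Put $\tilde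 v(x,t)=E(x,t,k)^{-1}v$ and $\mathcal O=\{(x,t)\in\mathcal O_1: B(\tilde v(x,t))\text{ is nonsingular}\}$. Then $\mathcal O$ is open and contains $(0,0)$. On $\mathcal O$ put $$\tilde Y=-kaB(\tilde v)aB(\tilde v)^{-1},\qquad \tilde u=aua^{-1}+[\tilde Y,a]a^{-1}.$$ 1. $\tilde u$ is a solution of the KW equation on $\mathcal O$. 2. $\tilde E(x,t,\lambda)=p_{v,k}(\lambda)E(x,t,\lambda)p_{\tilde v(x,t),k}(\lambda)^{-1}$, defined for $(x,t)\in\mathcal O$ and $\lambda^n\ne k^n$, extends to a map on $\mathcal O\times\mathbb C$ which has values in $GL(n,\mathbb C)$, is holomorphic in $\lambda\in\mathbb C$, and is a trivialization of $\tilde u$ on $\mathcal O$ normalized at $(0,0)$. 3. $Y=\tilde Y$ is smooth on $\mathcal O$ and solves $$\begin{cases}Y_x=Yu-(aua^{-1}+[Y,a]a^{-1})Y,\\ Y_t=Y\,Q_{a,n+1}(u)-Q_{a,n+1}(aua^{-1}+[Y,a]a^{-1})\,Y,\\ \tau^{-1}Y\tau=Y.\end{cases}$$ -/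

import Mathlib

open Matrix
open scoped ContDiff

noncomputable section

/- The matrix space is finite dimensional, so smoothness and derivatives do not depend on the
norm; we fix the operator norm coming from the sup norm. -/
attribute [local instance] Matrix.linftyOpNormedRing Matrix.linftyOpNormedAlgebra

namespace KW

/-- Complex `n × n` matrices. -/
abbrev Mat (n : ℕ) : Type := Matrix (Fin n) (Fin n) ℂ

/-- The primitive root of unity `α = exp (2πi / n)`. -/
def root (n : ℕ) : ℂ := Complex.exp (2 * (Real.pi : ℂ) * Complex.I / (n : ℂ))

/-- `a = diag (1, α, …, α ^ (n-1))`. -/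
def aMat (n : ℕ) : Mat n := Matrix.diagonal fun i => root n ^ (i : ℕ)

/-- The matrix `τ` of the cyclic permutation `(1 2 ⋯ n)`: `τ e_i = e_{i+1}`, indices mod `n`. -/
def tau (n : ℕ) : Mat n := Matrix.of fun i j => if i = finRotate n j then 1 else 0

/-- `𝒢_k`: the eigenspace of `y ↦ τ⁻¹ y τ` with eigenvalue `α ^ k`. -/
def eigSpace (n k : ℕ) : Set (Mat n) :=
  {y | (tau n)⁻¹ * y * tau n = root n ^ k • y}

/-- `sl(n)_a`: the centralizer of `a` in `sl(n, ℂ)`. -/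
def slCent (n : ℕ) : Set (Mat n) :=
  {y | y.trace = 0 ∧ aMat n * y - y * aMat n = 0}

/-- `sl(n)_a^⊥`: the orthogonal complement in `sl(n, ℂ)`, for the trace form, of `sl(n)_a`. -/
def slPerp (n : ℕ) : Set (Mat n) :=
  {y | y.trace = 0 ∧ ∀ b ∈ slCent n, (b * y).trace = 0}

/-- The `x`-derivative of a matrix valued function of `(x, t)`. -/
def dx {n : ℕ} (f : ℝ × ℝ → Mat n) (p : ℝ × ℝ) : Mat n := deriv (fun s : ℝ => f (s, p.2)) p.1

/-- The `t`-derivative of a matrix valued function of `(x, t)`. -/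
def dt {n : ℕ} (f : ℝ × ℝ → Mat n) (p : ℝ × ℝ) : Mat n := deriv (fun s : ℝ => f (p.1, s)) p.2

/-- The polynomial differential operators `Q_{a,j}` of the `sl(n, ℂ)`-hierarchy, `Q_{a,0} = a`.
The off-diagonal part of `Q_{a,j+1}(u)` is determined by
`(Q_{a,j}(u))_x + [u, Q_{a,j}(u)] = [Q_{a,j+1}(u), a]`. Its diagonal part `T` is determined by
the coefficient of `λ ^ (-(j+1))` in `(a + Q_{a,1} λ⁻¹ + Q_{a,2} λ⁻² + ⋯) ^ n = 1`
(`z ^ n - 1` is the minimal polynomial of `a`). With `S` the contribution of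
`Q_{a,0}, …, Q_{a,j}` to that coefficient, the diagonal part of this equation is
`n a ^ (n-1) T + diag S = 0`, that is, `T = - a (diag S) / n`.
The formal variable `λ⁻¹` is the polynomial variable `X` below. -/
def Q {n : ℕ} (u : ℝ × ℝ → Mat n) : ℕ → ℝ × ℝ → Mat n
  | 0 => fun _ => aMat n
  | j + 1 => fun p =>
      let R : Mat n := dx (Q u j) p + (u p * Q u j p - Q u j p * u p)
      let S : Mat n :=
        ((∑ i : Fin (j + 1), Polynomial.monomial (i : ℕ) (Q u (i : ℕ) p)) ^ n).coeff (j + 1)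
      Matrix.of fun r s =>
        if r = s then -(aMat n r r * S r r) / (n : ℂ)
        else R r s / (aMat n s s - aMat n r r)
  termination_by j => j
  decreasing_by
    all_goals first | exact i.isLt | exact Nat.lt_succ_self _

/-- `u : O → 𝒢_0 ∩ sl(n)_a^⊥` is a smooth solution of the Kupershmidt–Wilson equation
`u_t = (Q_{a,n+1}(u))_x + [u, Q_{a,n+1}(u)]`, the `(n+1)`-th flow defined by `a`. -/
structure IsSolution (n : ℕ) (O : Set (ℝ × ℝ)) (u : ℝ × ℝ → Mat n) : Prop where
  smooth : ContDiffOn ℝ ∞ u O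
  mem : ∀ p ∈ O, u p ∈ eigSpace n 0 ∩ slPerp n
  eqn : ∀ p ∈ O, dt u p = dx (Q u (n + 1)) p + (u p * Q u (n + 1) p - Q u (n + 1) p * u p)

/-- `E` is a trivialization of `u` over `O` normalized at `(0,0)`: for every `λ`, `E(·, λ)` is a
smooth solution of `E_x = E (a λ + u)`,
`E_t = E (a λ^{n+1} + Q_{a,1}(u) λ^n + ⋯ + Q_{a,n+1}(u))`, `E(0,0,λ) = 1`. -/
structure IsTrivialization (n : ℕ) (O : Set (ℝ × ℝ)) (u : ℝ × ℝ → Mat n)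
    (E : ℝ × ℝ → ℂ → Mat n) : Prop where
  smooth : ∀ z : ℂ, ContDiffOn ℝ ∞ (fun p => E p z) O
  eqn_x : ∀ z : ℂ, ∀ p ∈ O, dx (fun q => E q z) p = E p z * (z • aMat n + u p)
  eqn_t : ∀ z : ℂ, ∀ p ∈ O, dt (fun q => E q z) p =
    E p z * ∑ j ∈ Finset.range (n + 2), z ^ (n + 1 - j) • Q u j p
  normalized : ∀ z : ℂ, E (0, 0) z = 1

/-- `B(v)`: the matrix with columns `v, τ⁻¹ v, …, τ^{-(n-1)} v`. -/
def B {n : ℕ} (v : Fin n → ℂ) : Mat n :=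
  Matrix.of fun i j => (((tau n)⁻¹ ^ (j : ℕ)) *ᵥ v) i

/-- `-k a B(v) a B(v)⁻¹`. -/
def Ymat {n : ℕ} (v : Fin n → ℂ) (k : ℂ) : Mat n :=
  -(k • (aMat n * B v * aMat n * (B v)⁻¹))

/-- `p_{v,k}(λ) = a λ - k a B(v) a B(v)⁻¹`, for nonsingular `B(v)`. -/
def pMat {n : ℕ} (v : Fin n → ℂ) (k z : ℂ) : Mat n := z • aMat n + Ymat v k

/-- `a u a⁻¹ + [Y, a] a⁻¹`. -/
def transform {n : ℕ} (u Y : ℝ × ℝ → Mat n) (p : ℝ × ℝ) : Mat n :=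
  aMat n * u p * (aMat n)⁻¹ + (Y p * aMat n - aMat n * Y p) * (aMat n)⁻¹

/-- `Y` is a smooth solution over `O` of the Bäcklund system
`Y_x = Y u - ũ Y`, `Y_t = Y Q_{a,n+1}(u) - Q_{a,n+1}(ũ) Y`, `τ⁻¹ Y τ = Y`, where
`ũ = a u a⁻¹ + [Y, a] a⁻¹`. -/
structure IsBacklundSolution (n : ℕ) (O : Set (ℝ × ℝ)) (u Y : ℝ × ℝ → Mat n) : Prop where
  smooth : ContDiffOn ℝ ∞ Y O
  eqn_x : ∀ p ∈ O, dx Y p = Y p * u p - transform u Y p * Y p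
  eqn_t : ∀ p ∈ O, dt Y p =
    Y p * Q u (n + 1) p - Q (transform u Y) (n + 1) p * Y p
  reality : ∀ p ∈ O, (tau n)⁻¹ * Y p * tau n = Y p

end KW

end

/-! Put `X = λ⁻¹`. The generating series `∑ Q_{a,j}(u) X ^ j` is characterized by flatness for the
connection `a λ + u` together with the condition that its `n`-th power is `1`: at each order the
first condition fixes the off-diagonal part of a coefficient and the second its diagonal part. This
uniqueness yields both the `τ`-symmetry of the hierarchy and, when `Y_x = Y u - ũ Y`, the
intertwining relation `Q(ũ) (a + Y X) = (a + Y X) Q(u)`, from which the equation for `ũ` follows.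

A trivialization solves a linear total differential system, so it is invertible, entire in `λ`, and
satisfies `E(α λ) = τ⁻¹ E(λ) τ`. By this symmetry `E(α ^ j k)` maps `τ^{-j} ṽ` to `τ^{-j} v`. These
vectors span the kernels of `p_{ṽ,k}` and `p_{v,k}` at `λ = α ^ j k`, so the singularities of
`p_{v,k} E p_{ṽ,k}⁻¹` are removable. The gauge identity gives its equations off the
roots of `λ ^ n = k ^ n`, and a limit in the total system gives them at the roots. -/

namespace KW

section CyclicSymmetry

variable {n : ℕ}

/-- The algebra automorphism `y ↦ τ⁻¹ y τ` of `gl(n, ℂ)`, which shifts both indices cyclically;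
see `tau_inv_mul_mul_tau`. -/
noncomputable def cycConj (n : ℕ) : Mat n ≃ₐ[ℂ] Mat n :=
  Matrix.reindexAlgEquiv ℂ ℂ (finRotate n).symm

theorem tau_eq_permMatrix : tau n = (finRotate n)⁻¹.permMatrix ℂ := by
  ext i j
  simp only [tau, Matrix.of_apply, PEquiv.toMatrix_apply, Equiv.toPEquiv_apply, Option.mem_some_iff,
    Equiv.Perm.inv_def, Equiv.symm_apply_eq]

theorem tau_inv_eq_permMatrix : (tau n)⁻¹ = (finRotate n).permMatrix ℂ := by
  refine Matrix.inv_eq_left_inv ?_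
  rw [tau_eq_permMatrix, ← Matrix.permMatrix_mul, inv_mul_cancel, Matrix.permMatrix_one]

theorem isUnit_det_tau : IsUnit (tau n).det := by
  rw [tau_eq_permMatrix, Matrix.det_permutation]
  exact (Equiv.Perm.sign _).isUnit.map (Int.castRingHom ℂ)

theorem tau_inv_mul (y : Mat n) : (tau n)⁻¹ * y = y.submatrix (finRotate n) id := by
  rw [tau_inv_eq_permMatrix, PEquiv.toMatrix_toPEquiv_mul]

theorem mul_tau (y : Mat n) : y * tau n = y.submatrix id (finRotate n) := by
  rw [tau_eq_permMatrix, PEquiv.mul_toMatrix_toPEquiv, Equiv.Perm.inv_def, Equiv.symm_symm]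

theorem tau_inv_mul_mul_tau (y : Mat n) : (tau n)⁻¹ * y * tau n = cycConj n y := by
  rw [tau_inv_mul, mul_tau]
  rfl

theorem mem_eigSpace_zero_iff {y : Mat n} : y ∈ eigSpace n 0 ↔ cycConj n y = y := by
  simp [eigSpace, tau_inv_mul_mul_tau]

theorem root_isPrimitiveRoot (hn : n ≠ 0) : IsPrimitiveRoot (root n) n :=
  Complex.isPrimitiveRoot_exp n hn

theorem root_ne_zero : root n ≠ 0 := Complex.exp_ne_zero _

theorem aMat_apply_self (i : Fin n) : aMat n i i = root n ^ (i : ℕ) :=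
  Matrix.diagonal_apply_eq _ i

theorem isUnit_det_aMat : IsUnit (aMat n).det := by
  rw [aMat, Matrix.det_diagonal, isUnit_iff_ne_zero]
  exact Finset.prod_ne_zero_iff.2 fun i _ => pow_ne_zero _ root_ne_zero

variable [NeZero n]

theorem root_pow_self : root n ^ n = 1 :=
  (root_isPrimitiveRoot (NeZero.ne n)).pow_eq_one

theorem cycConj_apply (y : Mat n) (i j : Fin n) : cycConj n y i j = y (i + 1) (j + 1) := by
  simp [cycConj]

theorem one_add_ofNat (l : ℕ) : 1 + Fin.ofNat n l = Fin.ofNat n (l + 1) := by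
  ext
  simp [Fin.val_add, Fin.ofNat, add_comm]

theorem cycConj_iterate_apply (y : Mat n) (m i j : Fin n) :
    (cycConj n)^[m] y i j = y (i + m) (j + m) := by
  suffices h : ∀ (l : ℕ) (i j : Fin n),
      (cycConj n)^[l] y i j = y (i + Fin.ofNat n l) (j + Fin.ofNat n l) by
    rw [h, Fin.ofNat_val_eq_self]
  intro l
  induction l with
  | zero => simp [Fin.ofNat]
  | succ l ih =>
    intro i j
    rw [Function.iterate_succ_apply', cycConj_apply, ih, add_assoc, add_assoc, one_add_ofNat]

theorem B_apply (w : Fin n → ℂ) (i j : Fin n) : B w i j = w (i + j) := by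
  suffices h : ∀ (l : ℕ) (i : Fin n), (((tau n)⁻¹ ^ l) *ᵥ w) i = w (i + Fin.ofNat n l) by
    rw [B, Matrix.of_apply, h, Fin.ofNat_val_eq_self]
  intro l
  induction l with
  | zero => simp [Fin.ofNat]
  | succ l ih =>
    intro i
    rw [pow_succ', ← Matrix.mulVec_mulVec, tau_inv_eq_permMatrix, Matrix.permMatrix_mulVec,
      ← tau_inv_eq_permMatrix, Function.comp_apply, finRotate_apply, ih, add_assoc, one_add_ofNat]

theorem tau_inv_mul_B (w : Fin n → ℂ) : (tau n)⁻¹ * B w = B w * tau n := by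
  ext i j
  simp [tau_inv_mul, mul_tau, B_apply, add_right_comm, add_assoc]

theorem cycConj_iterate_mul_B_apply (q : Mat n) (w : Fin n → ℂ) (i j : Fin n) :
    ((cycConj n)^[j] q * B w) i j = B (q *ᵥ w) i j := by
  rw [B_apply, Matrix.mul_apply, Matrix.mulVec, dotProduct,
    ← Equiv.sum_comp (Equiv.addRight j) fun l => q (i + j) l * w l]
  exact Finset.sum_congr rfl fun l _ => by
    rw [cycConj_iterate_apply, B_apply, Equiv.coe_addRight]

theorem B_mulVec {q : Mat n} {e : ℕ} (hq : cycConj n q = root n ^ e • q) (w : Fin n → ℂ) :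
    B (q *ᵥ w) = q * B w * aMat n ^ e := by
  have hiter : ∀ l : ℕ, (cycConj n)^[l] q = (root n ^ e) ^ l • q := by
    intro l
    induction l with
    | zero => simp
    | succ l ih => rw [Function.iterate_succ_apply', ih, map_smul, hq, smul_smul, pow_succ]
  ext i j
  rw [← cycConj_iterate_mul_B_apply, hiter, aMat, Matrix.diagonal_pow, Matrix.mul_diagonal,
    Matrix.smul_mul, Matrix.smul_apply, smul_eq_mul, mul_comm, Pi.pow_apply, pow_right_comm]

theorem cycConj_aMat : cycConj n (aMat n) = root n • aMat n := by
  ext i j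
  rw [cycConj_apply, Matrix.smul_apply, aMat, Matrix.diagonal_apply, Matrix.diagonal_apply]
  by_cases h : i = j
  · rw [if_pos (by rw [h]), if_pos h, smul_eq_mul, ← pow_succ', Fin.val_add, Fin.val_one',
      Nat.add_mod_mod, ← pow_eq_pow_mod _ root_pow_self]
  · rw [if_neg (by simpa using h), if_neg h, smul_zero]

theorem aMat_apply_self_sub_ne_zero {i j : Fin n} (h : i ≠ j) :
    aMat n i i - aMat n j j ≠ 0 := by
  rw [aMat_apply_self, aMat_apply_self, sub_ne_zero]
  exact fun h' => h (Fin.ext ((root_isPrimitiveRoot (NeZero.ne n)).pow_inj i.2 j.2 h'))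

theorem aMat_pow_self : aMat n ^ n = 1 := by
  rw [aMat, Matrix.diagonal_pow, ← Matrix.diagonal_one]
  congr 1
  ext i
  rw [Pi.pow_apply, ← pow_mul, mul_comm, pow_mul, root_pow_self, one_pow]

theorem apply_eq_zero_of_commute_aMat {y : Mat n} (h : aMat n * y = y * aMat n) {i j : Fin n}
    (hij : i ≠ j) : y i j = 0 := by
  have hy := congrFun (congrFun h i) j
  rw [aMat, Matrix.diagonal_mul, Matrix.mul_diagonal, mul_comm, ← sub_eq_zero, ← mul_sub,
    ← aMat_apply_self, ← aMat_apply_self] at hy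
  exact (mul_eq_zero.1 hy).resolve_right (aMat_apply_self_sub_ne_zero hij)

theorem mem_slPerp_iff {y : Mat n} : y ∈ slPerp n ↔ ∀ i, y i i = 0 := by
  constructor
  · rintro ⟨htrace, hperp⟩ i
    have hdiag : ∀ r, y r r = y i i := by
      intro r
      have hb : (Matrix.diagonal (Pi.single r 1 - Pi.single i 1) : Mat n) ∈ slCent n := by
        refine ⟨by simp [Matrix.trace_diagonal], ?_⟩
        rw [aMat, (Matrix.commute_diagonal _ _).eq, sub_self]
      simpa [Matrix.trace, Matrix.diagonal_mul, sub_mul, Pi.single_apply, sub_eq_zero]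
        using hperp _ hb
    simpa [Matrix.trace, hdiag, NeZero.ne n] using htrace
  · refine fun hy => ⟨by simp [Matrix.trace, hy], fun b hb => ?_⟩
    refine Finset.sum_eq_zero fun i _ => ?_
    rw [Matrix.diag_apply, Matrix.mul_apply]
    refine Finset.sum_eq_zero fun j _ => ?_
    obtain rfl | hij := eq_or_ne i j
    · rw [hy, mul_zero]
    · rw [apply_eq_zero_of_commute_aMat (sub_eq_zero.1 hb.2) hij, zero_mul]

end CyclicSymmetry

section TelescopingPower

variable {R : Type*} [Ring R]

/-- The sum `∑_{i < N} S ^ i W T ^ (N - 1 - i)`. For `S = T` it is the derivative of `F ↦ F ^ N`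
at `S` in the direction `W`. -/
def powDiff (S T W : R) : ℕ → R
  | 0 => 0
  | N + 1 => powDiff S T W N * T + S ^ N * W

theorem powDiff_intertwiner (S T π : R) (N : ℕ) :
    powDiff S T (S * π - π * T) N = S ^ N * π - π * T ^ N := by
  induction N with
  | zero => simp [powDiff]
  | succ N ih =>
    rw [powDiff, ih, pow_succ, pow_succ]
    noncomm_ring

theorem map_powDiff {R' : Type*} [Ring R'] (f : R →+* R') (S T W : R) (N : ℕ) :
    f (powDiff S T W N) = powDiff (f S) (f T) (f W) N := by
  induction N with
  | zero => exact map_zero f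
  | succ N ih => simp only [powDiff, map_add, map_mul, map_pow, ih]

theorem powDiff_mul_right_of_central {z : R} (hz : ∀ y, Commute z y) (S T W : R) (N : ℕ) :
    powDiff S T (W * z) N = powDiff S T W N * z := by
  induction N with
  | zero => simp [powDiff]
  | succ N ih =>
    rw [powDiff, powDiff, ih, add_mul, mul_assoc _ z, (hz T).eq, ← mul_assoc, ← mul_assoc]

open PowerSeries in
theorem coeff_powDiff_of_low (S T : R⟦X⟧) {W : R⟦X⟧} {m : ℕ} (hW : ∀ i < m, coeff i W = 0)
    (N : ℕ) :
    coeff m (powDiff S T W N) = powDiff (constantCoeff S) (constantCoeff T) (coeff m W) N := by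
  obtain ⟨W', rfl⟩ := X_pow_dvd_iff.2 hW
  have hpow := powDiff_mul_right_of_central (fun F => (commute_X_pow F m).symm) S T W' N
  rw [← (commute_X_pow W' m).eq, hpow]
  have hcoeff : ∀ F : R⟦X⟧, coeff m (F * X ^ m) = constantCoeff F := fun F => by
    simpa using coeff_mul_X_pow F m 0
  rw [hcoeff, hcoeff, map_powDiff]

end TelescopingPower

theorem powDiff_diagonal_apply_self {ι A : Type*} [Fintype ι] [DecidableEq ι] [CommRing A]
    (d : ι → A) (y : Matrix ι ι A) (N : ℕ) (r : ι) :
    powDiff (diagonal d) (diagonal d) y N r r = N * d r ^ (N - 1) * y r r := by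
  induction N with
  | zero => simp [powDiff]
  | succ N ih =>
    rw [powDiff, Matrix.add_apply, Matrix.mul_diagonal, ih, Matrix.diagonal_pow,
      Matrix.diagonal_mul, Pi.pow_apply]
    rcases N with _ | N
    · simp
    · push_cast
      simp only [pow_succ]
      ring

section Calculus

attribute [local instance] Matrix.linftyOpNormedRing Matrix.linftyOpNormedAlgebra

variable {n : ℕ}

/-- A matrix seen as the family of its entries, for the topology of the operator norm. -/
noncomputable def entriesCLE (n : ℕ) : Mat n ≃L[ℝ] (Fin n → Fin n → ℂ) :=
  (Matrix.ofLinearEquiv ℝ).symm.toContinuousLinearEquiv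

theorem contDiffOn_iff_entries {P : Type*} [NormedAddCommGroup P] [NormedSpace ℝ P] {s : Set P}
    {f : P → Mat n} {r : ℕ∞ω} :
    ContDiffOn ℝ r f s ↔ ∀ i j, ContDiffOn ℝ r (fun p => f p i j) s := by
  rw [← (entriesCLE n).comp_contDiffOn_iff, contDiffOn_pi]
  exact forall_congr' fun i => contDiffOn_pi

variable {O : Set (ℝ × ℝ)} {f : ℝ × ℝ → Mat n} {p : ℝ × ℝ}

theorem hasDerivAt_slice_fst {E : Type*} [NormedAddCommGroup E] [NormedSpace ℝ E]
    {g : ℝ × ℝ → E} {g' : ℝ × ℝ →L[ℝ] E} (h : HasFDerivAt g g' p) :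
    HasDerivAt (fun s => g (s, p.2)) (g' (1, 0)) p.1 :=
  HasFDerivAt.comp_hasDerivAt (f := fun s : ℝ => (s, p.2)) p.1 h
    ((hasDerivAt_id p.1).prodMk (hasDerivAt_const p.1 p.2))

theorem hasDerivAt_slice_snd {E : Type*} [NormedAddCommGroup E] [NormedSpace ℝ E]
    {g : ℝ × ℝ → E} {g' : ℝ × ℝ →L[ℝ] E} (h : HasFDerivAt g g' p) :
    HasDerivAt (fun s => g (p.1, s)) (g' (0, 1)) p.2 :=
  HasFDerivAt.comp_hasDerivAt (f := fun s : ℝ => (p.1, s)) p.2 h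
    ((hasDerivAt_const p.2 p.1).prodMk (hasDerivAt_id p.2))

theorem hasFDerivAt_of_contDiffOn (hO : IsOpen O) (hf : ContDiffOn ℝ ∞ f O) (hp : p ∈ O) :
    HasFDerivAt f (fderiv ℝ f p) p :=
  ((hf.contDiffAt (hO.mem_nhds hp)).differentiableAt (by simp)).hasFDerivAt

theorem dx_eq_fderiv (hO : IsOpen O) (hf : ContDiffOn ℝ ∞ f O) (hp : p ∈ O) :
    dx f p = fderiv ℝ f p (1, 0) :=
  (hasDerivAt_slice_fst (hasFDerivAt_of_contDiffOn hO hf hp)).deriv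

theorem dt_eq_fderiv (hO : IsOpen O) (hf : ContDiffOn ℝ ∞ f O) (hp : p ∈ O) :
    dt f p = fderiv ℝ f p (0, 1) :=
  (hasDerivAt_slice_snd (hasFDerivAt_of_contDiffOn hO hf hp)).deriv

theorem hasDerivAt_dx (hO : IsOpen O) (hf : ContDiffOn ℝ ∞ f O) (hp : p ∈ O) :
    HasDerivAt (fun s => f (s, p.2)) (dx f p) p.1 :=
  (hasDerivAt_slice_fst (hasFDerivAt_of_contDiffOn hO hf hp)).differentiableAt.hasDerivAt

theorem hasDerivAt_dt (hO : IsOpen O) (hf : ContDiffOn ℝ ∞ f O) (hp : p ∈ O) :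
    HasDerivAt (fun s => f (p.1, s)) (dt f p) p.2 :=
  (hasDerivAt_slice_snd (hasFDerivAt_of_contDiffOn hO hf hp)).differentiableAt.hasDerivAt

theorem contDiffOn_dx (hO : IsOpen O) (hf : ContDiffOn ℝ ∞ f O) : ContDiffOn ℝ ∞ (dx f) O :=
  ((hf.fderiv_of_isOpen hO (m := ∞) (by simp)).clm_apply contDiffOn_const).congr
    fun _ hp => dx_eq_fderiv hO hf hp

theorem dx_congr {g : ℝ × ℝ → Mat n} (hO : IsOpen O) (h : ∀ q ∈ O, f q = g q) (hp : p ∈ O) :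
    dx f p = dx g p :=
  Filter.EventuallyEq.deriv_eq <|
    ((Continuous.prodMk_left p.2).continuousAt.eventually (hO.mem_nhds hp)).mono fun _ hs => h _ hs

theorem dx_const (y : Mat n) : dx (fun _ => y) p = 0 := deriv_const _ _

theorem dx_map (φ : Mat n →ₗ[ℝ] Mat n) (hO : IsOpen O) (hf : ContDiffOn ℝ ∞ f O) (hp : p ∈ O) :
    dx (fun q => φ (f q)) p = φ (dx f p) :=
  (φ.toContinuousLinearMap.hasFDerivAt.comp_hasDerivAt p.1 (hasDerivAt_dx hO hf hp)).deriv

end Calculus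

section FlatSeries

attribute [local instance] Matrix.linftyOpNormedRing Matrix.linftyOpNormedAlgebra

open PowerSeries

variable {n : ℕ} {O : Set (ℝ × ℝ)} {u w : ℝ × ℝ → Mat n} {F G : ℝ × ℝ → (Mat n)⟦X⟧}
  {p : ℝ × ℝ}

/-- Coefficientwise smoothness of a family of power series. -/
def SmoothSeriesOn (F : ℝ × ℝ → (Mat n)⟦X⟧) (O : Set (ℝ × ℝ)) : Prop :=
  ∀ m, ContDiffOn ℝ ∞ (fun p => coeff m (F p)) O

/-- The coefficientwise `x`-derivative of a family of power series. -/
noncomputable def dxSeries (F : ℝ × ℝ → (Mat n)⟦X⟧) (p : ℝ × ℝ) : (Mat n)⟦X⟧ :=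
  PowerSeries.mk fun m => dx (fun q => coeff m (F q)) p

/-- The connection coefficient `a λ + y`, divided by `λ`, with `X = λ⁻¹`. -/
noncomputable def connSeries (y : Mat n) : (Mat n)⟦X⟧ := C (aMat n) + X * C y

/-- The series `λ⁻¹ F_x - (F (a λ + u) - (a λ + w) F) λ⁻¹`, with `X = λ⁻¹`. It vanishes when `F`
intertwines the connections `∂_x + a λ + w` and `∂_x + a λ + u`. -/
noncomputable def flatDefect (w u : ℝ × ℝ → Mat n) (F : ℝ × ℝ → (Mat n)⟦X⟧) (p : ℝ × ℝ) :
    (Mat n)⟦X⟧ :=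
  X * dxSeries F p - (F p * connSeries (u p) - connSeries (w p) * F p)

theorem SmoothSeriesOn.mul (hF : SmoothSeriesOn F O) (hG : SmoothSeriesOn G O) :
    SmoothSeriesOn (fun p => F p * G p) O := fun m => by
  simp only [coeff_mul]
  exact ContDiffOn.sum fun ij _ => (hF ij.1).mul (hG ij.2)

theorem SmoothSeriesOn.pow (hF : SmoothSeriesOn F O) (N : ℕ) :
    SmoothSeriesOn (fun p => F p ^ N) O := by
  induction N with
  | zero => exact fun m => by simpa only [pow_zero] using contDiffOn_const
  | succ N ih => simpa only [pow_succ] using ih.mul hF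

theorem dxSeries_mul (hO : IsOpen O) (hF : SmoothSeriesOn F O) (hG : SmoothSeriesOn G O)
    (hp : p ∈ O) :
    dxSeries (fun q => F q * G q) p = dxSeries F p * G p + F p * dxSeries G p := by
  ext1 m
  simp only [dxSeries, coeff_mk, map_add, coeff_mul, ← Finset.sum_add_distrib]
  exact (HasDerivAt.fun_sum fun ij _ =>
    (hasDerivAt_dx hO (hF ij.1) hp).mul (hasDerivAt_dx hO (hG ij.2) hp)).deriv

theorem dxSeries_sub (hO : IsOpen O) (hF : SmoothSeriesOn F O) (hG : SmoothSeriesOn G O)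
    (hp : p ∈ O) : dxSeries (fun q => F q - G q) p = dxSeries F p - dxSeries G p := by
  ext1 m
  simp only [dxSeries, coeff_mk, map_sub]
  exact ((hasDerivAt_dx hO (hF m) hp).sub (hasDerivAt_dx hO (hG m) hp)).deriv

theorem flatDefect_mul (hO : IsOpen O) (hF : SmoothSeriesOn F O) (hG : SmoothSeriesOn G O)
    (hp : p ∈ O) (v : ℝ × ℝ → Mat n) :
    flatDefect w u (fun q => F q * G q) p =
      flatDefect w v F p * G p + F p * flatDefect v u G p := by
  have hX : F p * (X * dxSeries G p) = X * (F p * dxSeries G p) := by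
    rw [← mul_assoc, ← mul_assoc, X_mul]
  simp only [flatDefect, dxSeries_mul hO hF hG hp, mul_sub, sub_mul, mul_add, hX, mul_assoc]
  abel

theorem flatDefect_sub (hO : IsOpen O) (hF : SmoothSeriesOn F O) (hG : SmoothSeriesOn G O)
    (hp : p ∈ O) :
    flatDefect w u (fun q => F q - G q) p = flatDefect w u F p - flatDefect w u G p := by
  simp only [flatDefect, dxSeries_sub hO hF hG hp, mul_sub, sub_mul]
  abel

theorem flatDefect_pow (hO : IsOpen O) (hF : SmoothSeriesOn F O) (hp : p ∈ O) (N : ℕ) :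
    flatDefect u u (fun q => F q ^ N) p = powDiff (F p) (F p) (flatDefect u u F p) N := by
  induction N with
  | zero =>
    have h : dxSeries (fun _ => (1 : (Mat n)⟦X⟧)) p = 0 := by
      ext1 m
      exact (coeff_mk _ _).trans (dx_const _)
    simp [flatDefect, powDiff, h]
  | succ N ih =>
    simp only [pow_succ, powDiff]
    rw [flatDefect_mul hO (hF.pow N) hF hp u, ih]

theorem coeff_zero_flatDefect :
    coeff 0 (flatDefect w u F p) = aMat n * coeff 0 (F p) - coeff 0 (F p) * aMat n := by
  simp [flatDefect, connSeries]

theorem coeff_succ_flatDefect (m : ℕ) :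
    coeff (m + 1) (flatDefect w u F p) = dx (fun q => coeff m (F q)) p -
      ((coeff (m + 1) (F p) * aMat n - aMat n * coeff (m + 1) (F p)) +
        (coeff m (F p) * u p - w p * coeff m (F p))) := by
  have h : F p * (X * C (u p)) = X * (F p * C (u p)) := by rw [← mul_assoc, ← mul_assoc, X_mul]
  simp only [flatDefect, connSeries, dxSeries, mul_add, add_mul, h, mul_assoc X, map_sub, map_add,
    coeff_succ_X_mul, coeff_mul_C, coeff_C_mul, coeff_mk]
  abel

theorem eq_zero_of_powDiff_aMat [NeZero n] {y : Mat n} (hcomm : aMat n * y = y * aMat n)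
    (hy : ∀ r, powDiff (aMat n) (aMat n) y n r r = 0) : y = 0 := by
  ext r s
  obtain rfl | hrs := eq_or_ne r s
  · have h := hy r
    rw [aMat, powDiff_diagonal_apply_self] at h
    simpa [NeZero.ne n, root_ne_zero] using h
  · exact apply_eq_zero_of_commute_aMat hcomm hrs

/-- An intertwiner of two connections is determined by one diagonal condition per coefficient:
flatness at order `m + 1` makes the coefficient of order `m` commute with `a` as soon as the lower
coefficients vanish. -/
theorem eq_zero_of_flatDefect_eq_zero [NeZero n] (hO : IsOpen O)
    {S T Δ : ℝ × ℝ → (Mat n)⟦X⟧} (hS : ∀ p ∈ O, constantCoeff (S p) = aMat n)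
    (hT : ∀ p ∈ O, constantCoeff (T p) = aMat n)
    (hflat : ∀ p ∈ O, flatDefect w u Δ p = 0)
    (hpow : ∀ p ∈ O, powDiff (S p) (T p) (Δ p) n = 0) :
    ∀ p ∈ O, Δ p = 0 := by
  suffices h : ∀ m, ∀ p ∈ O, coeff m (Δ p) = 0 from fun p hp => PowerSeries.ext fun m => h m p hp
  intro m
  induction m using Nat.strong_induction_on with
  | _ m ih =>
    intro p hp
    refine eq_zero_of_powDiff_aMat ?_ fun r => ?_
    · rcases m with _ | m
      · rw [← sub_eq_zero, ← coeff_zero_flatDefect, hflat p hp, map_zero]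
      · have h := coeff_succ_flatDefect (w := w) (u := u) (F := Δ) (p := p) m
        rw [hflat p hp, map_zero, dx_congr hO (ih m (Nat.lt_succ_self m)) hp, dx_const,
          ih m (Nat.lt_succ_self m) p hp] at h
        exact sub_eq_zero.1 (by simpa using h.symm)
    · have h := coeff_powDiff_of_low (S p) (T p) (fun i hi => ih i hi p hp) n
      rw [hpow p hp, map_zero, hS p hp, hT p hp] at h
      rw [← h, Matrix.zero_apply]

end FlatSeries

section Hierarchy

attribute [local instance] Matrix.linftyOpNormedRing Matrix.linftyOpNormedAlgebra

open PowerSeries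

variable {n : ℕ} {O : Set (ℝ × ℝ)} {u : ℝ × ℝ → Mat n} {p : ℝ × ℝ}

/-- The generating series `∑ Q_{a,j}(u) X ^ j` of the hierarchy, with `X = λ⁻¹`. -/
noncomputable def qSeries (u : ℝ × ℝ → Mat n) (p : ℝ × ℝ) : (Mat n)⟦X⟧ :=
  PowerSeries.mk fun j => Q u j p

/-- The part of order at most `j` of the generating series. -/
noncomputable def qTrunc (u : ℝ × ℝ → Mat n) (j : ℕ) (p : ℝ × ℝ) : (Mat n)⟦X⟧ :=
  (trunc (j + 1) (qSeries u p) : Polynomial (Mat n))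

theorem coeff_qSeries (j : ℕ) : coeff j (qSeries u p) = Q u j p := coeff_mk _ _

theorem Q_zero : Q u 0 p = aMat n := by rw [Q]

theorem constantCoeff_qSeries : constantCoeff (qSeries u p) = aMat n := by
  rw [← coeff_zero_eq_constantCoeff_apply, coeff_qSeries, Q_zero]

theorem coeff_qTrunc (j i : ℕ) : coeff i (qTrunc u j p) = if i < j + 1 then Q u i p else 0 := by
  rw [qTrunc, Polynomial.coeff_coe, coeff_trunc, coeff_qSeries]

theorem Q_succ_apply (j : ℕ) (r s : Fin n) :
    Q u (j + 1) p r s =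
      if r = s then -(aMat n r r * coeff (j + 1) (qTrunc u j p ^ n) r r) / (n : ℂ)
      else (dx (Q u j) p + (u p * Q u j p - Q u j p * u p)) r s / (aMat n s s - aMat n r r) := by
  have htrunc : trunc (j + 1) (qSeries u p) =
      ∑ i : Fin (j + 1), Polynomial.monomial (i : ℕ) (Q u i p) := by
    ext1 i
    rw [coeff_trunc, coeff_qSeries, Polynomial.finsetSum_coeff,
      Fin.sum_univ_eq_sum_range fun l => (Polynomial.monomial l (Q u l p)).coeff i]
    simp [Polynomial.coeff_monomial]
  rw [Q, qTrunc, ← Polynomial.coe_pow, Polynomial.coeff_coe, htrunc]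
  rfl

theorem contDiffOn_Q (hO : IsOpen O) (hu : ContDiffOn ℝ ∞ u O) (j : ℕ) :
    ContDiffOn ℝ ∞ (Q u j) O := by
  induction j using Nat.strong_induction_on with
  | _ j ih =>
    rcases j with _ | j
    · exact contDiffOn_const.congr fun p _ => Q_zero
    · refine contDiffOn_iff_entries.2 fun r s => ?_
      simp only [Q_succ_apply]
      split_ifs
      · have htrunc : SmoothSeriesOn (qTrunc u j) O := fun i => by
          simp only [coeff_qTrunc]
          split_ifs with hi
          exacts [ih i hi, contDiffOn_const]
        exact (contDiffOn_const.mul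
          (contDiffOn_iff_entries.1 (htrunc.pow n (j + 1)) r r)).neg.div_const _
      · have hj := ih j (Nat.lt_succ_self j)
        exact (contDiffOn_iff_entries.1
          ((contDiffOn_dx hO hj).add ((hu.mul hj).sub (hj.mul hu))) r s).div_const _

theorem smoothSeriesOn_qSeries (hO : IsOpen O) (hu : ContDiffOn ℝ ∞ u O) :
    SmoothSeriesOn (qSeries u) O := fun j => by
  simpa only [coeff_qSeries] using contDiffOn_Q hO hu j

variable [NeZero n]

theorem coeff_succ_flatDefect_qSeries_apply_ne (j : ℕ) {r s : Fin n} (hrs : r ≠ s) :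
    coeff (j + 1) (flatDefect u u (qSeries u) p) r s = 0 := by
  have hQ := Q_succ_apply (u := u) (p := p) j r s
  rw [if_neg hrs, eq_div_iff (aMat_apply_self_sub_ne_zero hrs.symm), mul_sub] at hQ
  have hcomm : (Q u (j + 1) p * aMat n - aMat n * Q u (j + 1) p) r s =
      Q u (j + 1) p r s * aMat n s s - Q u (j + 1) p r s * aMat n r r := by
    rw [aMat_apply_self, aMat_apply_self, aMat, Matrix.sub_apply, Matrix.mul_diagonal,
      Matrix.diagonal_mul, mul_comm (root n ^ (r : ℕ))]
  rw [coeff_succ_flatDefect]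
  simp only [coeff_qSeries]
  rw [Matrix.sub_apply, Matrix.add_apply, hcomm, hQ]
  simp only [Matrix.add_apply, Matrix.sub_apply]
  ring

theorem coeff_succ_qSeries_pow_apply_self (j : ℕ) (r : Fin n) :
    coeff (j + 1) (qSeries u p ^ n) r r = 0 := by
  have hlow : ∀ i < j + 1, coeff i (qSeries u p - qTrunc u j p) = 0 := fun i hi => by
    rw [map_sub, coeff_qSeries, coeff_qTrunc, if_pos hi, sub_self]
  have htop : coeff (j + 1) (qSeries u p - qTrunc u j p) = Q u (j + 1) p := by
    rw [map_sub, coeff_qSeries, coeff_qTrunc, if_neg (lt_irrefl _), sub_zero]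
  have htrunc : constantCoeff (qTrunc u j p) = aMat n := by
    rw [← coeff_zero_eq_constantCoeff_apply, coeff_qTrunc, if_pos (Nat.succ_pos j), Q_zero]
  have hdiff : coeff (j + 1) (qSeries u p ^ n) - coeff (j + 1) (qTrunc u j p ^ n) =
      powDiff (aMat n) (aMat n) (Q u (j + 1) p) n := by
    have h := powDiff_intertwiner (qSeries u p) (qTrunc u j p) 1 n
    rw [mul_one, one_mul, mul_one, one_mul] at h
    rw [← map_sub, ← h, coeff_powDiff_of_low _ _ hlow, htop, htrunc, constantCoeff_qSeries]
  have hn : (n : ℂ) ≠ 0 := Nat.cast_ne_zero.2 (NeZero.ne n)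
  have ha : (root n ^ (r : ℕ)) ^ (n - 1) * root n ^ (r : ℕ) = 1 := by
    rw [pow_sub_one_mul (NeZero.ne n), pow_right_comm, root_pow_self, one_pow]
  rw [sub_eq_iff_eq_add.1 hdiff, Matrix.add_apply, aMat, powDiff_diagonal_apply_self,
    Q_succ_apply, if_pos rfl, aMat_apply_self]
  field_simp
  linear_combination (-coeff (j + 1) (qTrunc u j p ^ n) r r) * ha

/-- Both defining properties of the hierarchy, with the diagonal part of the recursion, which is
not imposed by the definition: the `n`-th power of the series is flat up to order `m + 1`, so that
the defect of the series at that order, a diagonal matrix, is annihilated by `n a ^ (n - 1)`. -/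
theorem coeff_flatDefect_qSeries_and_pow (hO : IsOpen O) (hu : ContDiffOn ℝ ∞ u O) (m : ℕ) :
    ∀ p ∈ O, coeff m (flatDefect u u (qSeries u) p) = 0 ∧
      coeff m (qSeries u p ^ n) = coeff m 1 := by
  induction m using Nat.strong_induction_on with
  | _ m ih =>
    intro p hp
    rcases m with _ | m
    · refine ⟨by rw [coeff_zero_flatDefect, coeff_qSeries, Q_zero, sub_self], ?_⟩
      rw [coeff_zero_eq_constantCoeff_apply, map_pow, constantCoeff_qSeries, aMat_pow_self]
      simp
    have hkey : powDiff (aMat n) (aMat n) (coeff (m + 1) (flatDefect u u (qSeries u) p)) n =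
        aMat n * coeff (m + 1) (qSeries u p ^ n) - coeff (m + 1) (qSeries u p ^ n) * aMat n := by
      have hlow := coeff_powDiff_of_low (qSeries u p) (qSeries u p)
        (fun i hi => (ih i hi p hp).1) n
      have hconst : dx (fun q => coeff m (qSeries u q ^ n)) p = 0 :=
        (dx_congr hO (fun q hq => (ih m (Nat.lt_succ_self m) q hq).2) hp).trans (dx_const _)
      rw [constantCoeff_qSeries, ← flatDefect_pow hO (smoothSeriesOn_qSeries hO hu) hp,
        coeff_succ_flatDefect, hconst, (ih m (Nat.lt_succ_self m) p hp).2] at hlow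
      rw [← hlow, coeff_one]
      split_ifs <;> simp
    have hflat : coeff (m + 1) (flatDefect u u (qSeries u) p) = 0 := by
      ext r s
      obtain rfl | hrs := eq_or_ne r s
      · have h := congrFun (congrFun hkey r) r
        rw [Matrix.sub_apply, aMat, powDiff_diagonal_apply_self, Matrix.diagonal_mul,
          Matrix.mul_diagonal, mul_comm (root n ^ (r : ℕ)), sub_self] at h
        simpa [NeZero.ne n, root_ne_zero] using h
      · exact coeff_succ_flatDefect_qSeries_apply_ne m hrs
    refine ⟨hflat, ?_⟩
    have hzero : powDiff (aMat n) (aMat n) 0 n = 0 := by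
      simpa using powDiff_mul_right_of_central (Commute.zero_left) (aMat n) (aMat n) 0 n
    rw [hflat, hzero, eq_comm, sub_eq_zero] at hkey
    rw [coeff_one, if_neg (Nat.succ_ne_zero m)]
    ext r s
    obtain rfl | hrs := eq_or_ne r s
    exacts [coeff_succ_qSeries_pow_apply_self m r, apply_eq_zero_of_commute_aMat hkey hrs]

theorem flatDefect_qSeries (hO : IsOpen O) (hu : ContDiffOn ℝ ∞ u O) (hp : p ∈ O) :
    flatDefect u u (qSeries u) p = 0 :=
  PowerSeries.ext fun m => (coeff_flatDefect_qSeries_and_pow hO hu m p hp).1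

theorem Q_recursion (hO : IsOpen O) (hu : ContDiffOn ℝ ∞ u O) (hp : p ∈ O) (j : ℕ) :
    dx (Q u j) p + (u p * Q u j p - Q u j p * u p) =
      Q u (j + 1) p * aMat n - aMat n * Q u (j + 1) p := by
  have h := congrArg (coeff (j + 1)) (flatDefect_qSeries hO hu hp)
  simp only [coeff_succ_flatDefect, coeff_qSeries, map_zero] at h
  rw [← sub_eq_zero, ← h]
  abel

theorem qSeries_pow_self (hO : IsOpen O) (hu : ContDiffOn ℝ ∞ u O) (hp : p ∈ O) :
    qSeries u p ^ n = 1 :=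
  PowerSeries.ext fun m => (coeff_flatDefect_qSeries_and_pow hO hu m p hp).2

end Hierarchy

section HierarchySymmetry

attribute [local instance] Matrix.linftyOpNormedRing Matrix.linftyOpNormedAlgebra

open PowerSeries

/-- The ring endomorphism `∑ F_j X ^ j ↦ ∑ σ (F_j) (c X) ^ j` of power series. -/
noncomputable def twist {k R : Type*} [CommRing k] [Ring R] [Algebra k R] (σ : R →ₐ[k] R) (c : k) :
    R⟦X⟧ →+* R⟦X⟧ where
  toFun F := PowerSeries.mk fun j => c ^ j • σ (coeff j F)
  map_one' := by
    ext j
    rcases j with _ | j <;> simp [coeff_one]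
  map_zero' := by
    ext j
    simp
  map_add' F G := by
    ext j
    simp
  map_mul' F G := by
    ext j
    simp only [coeff_mk, coeff_mul, map_sum, map_mul, Finset.smul_sum, smul_mul_smul_comm,
      ← pow_add]
    exact Finset.sum_congr rfl fun ij hij => by rw [Finset.HasAntidiagonal.mem_antidiagonal.1 hij]

variable {n : ℕ} {O : Set (ℝ × ℝ)} {u : ℝ × ℝ → Mat n} {p : ℝ × ℝ}

/-- The image of the hierarchy of `u` under `τ⁻¹ · τ` and `λ ↦ α⁻¹ λ`, normalized so as to start
with `a`. -/
noncomputable def twistedSeries (u : ℝ × ℝ → Mat n) (p : ℝ × ℝ) : (Mat n)⟦X⟧ :=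
  (root n)⁻¹ • twist (cycConj n : Mat n →ₐ[ℂ] Mat n) (root n) (qSeries u p)

theorem coeff_twistedSeries (j : ℕ) :
    coeff j (twistedSeries u p) = ((root n)⁻¹ * root n ^ j) • cycConj n (Q u j p) := by
  simp [twistedSeries, twist, coeff_qSeries, mul_smul]

theorem smoothSeriesOn_twistedSeries (hO : IsOpen O) (hu : ContDiffOn ℝ ∞ u O) :
    SmoothSeriesOn (twistedSeries u) O := fun j => by
  simp only [coeff_twistedSeries]
  exact ((cycConj n).toLinearMap.restrictScalars ℝ).toContinuousLinearMap.contDiff.comp_contDiffOn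
    (contDiffOn_Q hO hu j) |>.const_smul _

variable [NeZero n]

theorem constantCoeff_twistedSeries : constantCoeff (twistedSeries u p) = aMat n := by
  rw [← coeff_zero_eq_constantCoeff_apply, coeff_twistedSeries, Q_zero, cycConj_aMat, smul_smul,
    pow_zero, mul_one, inv_mul_cancel₀ root_ne_zero, one_smul]

theorem twistedSeries_pow_self (hO : IsOpen O) (hu : ContDiffOn ℝ ∞ u O) (hp : p ∈ O) :
    twistedSeries u p ^ n = 1 := by
  rw [twistedSeries, smul_pow, ← map_pow, qSeries_pow_self hO hu hp, map_one, inv_pow,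
    root_pow_self, inv_one, one_smul]

theorem flatDefect_twistedSeries (hO : IsOpen O) (hu : ContDiffOn ℝ ∞ u O)
    (hτ : ∀ p ∈ O, cycConj n (u p) = u p) (hp : p ∈ O) :
    flatDefect u u (twistedSeries u) p = 0 := by
  ext1 m
  rcases m with _ | m
  · rw [coeff_zero_flatDefect, coeff_zero_eq_constantCoeff_apply, constantCoeff_twistedSeries,
      sub_self, map_zero]
  have hdx : dx (fun q => coeff m (twistedSeries u q)) p =
      ((root n)⁻¹ * root n ^ m) • cycConj n (dx (Q u m) p) := by
    simp only [coeff_twistedSeries]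
    exact dx_map ((((root n)⁻¹ * root n ^ m) • (cycConj n).toLinearMap).restrictScalars ℝ) hO
      (contDiffOn_Q hO hu m) hp
  have h := coeff_succ_flatDefect (w := u) (u := u) (F := qSeries u) (p := p) m
  rw [flatDefect_qSeries hO hu hp, map_zero, eq_comm, sub_eq_zero] at h
  simp only [coeff_qSeries] at h
  rw [coeff_succ_flatDefect, hdx, h]
  simp only [coeff_twistedSeries, map_add, map_sub, map_mul, cycConj_aMat, hτ p hp,
    Matrix.mul_smul, Matrix.smul_mul, smul_add, smul_sub, smul_smul, pow_succ, mul_assoc, map_zero,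
    sub_self]

theorem cycConj_Q (hO : IsOpen O) (hu : ContDiffOn ℝ ∞ u O)
    (hτ : ∀ p ∈ O, cycConj n (u p) = u p) {N j : ℕ} (hj : j ≤ N) (hN : root n ^ N = root n)
    (hp : p ∈ O) : cycConj n (Q u j p) = root n ^ (N - j) • Q u j p := by
  have hzero : twistedSeries u p - qSeries u p = 0 := by
    refine eq_zero_of_flatDefect_eq_zero (w := u) (u := u) hO (S := twistedSeries u)
      (T := qSeries u) (Δ := fun q => twistedSeries u q - qSeries u q)
      (fun q _ => constantCoeff_twistedSeries) (fun q _ => constantCoeff_qSeries)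
      (fun q hq => ?_) (fun q hq => ?_) p hp
    · rw [flatDefect_sub hO (smoothSeriesOn_twistedSeries hO hu) (smoothSeriesOn_qSeries hO hu) hq,
        flatDefect_twistedSeries hO hu hτ hq, flatDefect_qSeries hO hu hq, sub_self]
    · have h := powDiff_intertwiner (twistedSeries u q) (qSeries u q) 1 n
      rwa [mul_one, one_mul, mul_one, one_mul, twistedSeries_pow_self hO hu hq,
        qSeries_pow_self hO hu hq, sub_self] at h
  have h := congrArg (coeff j) (sub_eq_zero.1 hzero)
  rw [coeff_twistedSeries, coeff_qSeries] at h
  conv_rhs => rw [← h]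
  rw [smul_smul, mul_left_comm, ← pow_add, Nat.sub_add_cancel hj, hN,
    inv_mul_cancel₀ root_ne_zero, one_smul]

end HierarchySymmetry

section Darboux

attribute [local instance] Matrix.linftyOpNormedRing Matrix.linftyOpNormedAlgebra

open PowerSeries

variable {n : ℕ} {O : Set (ℝ × ℝ)} {u Y : ℝ × ℝ → Mat n} {p : ℝ × ℝ}

theorem transform_mul_aMat :
    transform u Y p * aMat n = aMat n * u p + (Y p * aMat n - aMat n * Y p) := by
  rw [transform, Matrix.add_mul, Matrix.nonsing_inv_mul_cancel_right _ _ isUnit_det_aMat,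
    Matrix.nonsing_inv_mul_cancel_right _ _ isUnit_det_aMat]

theorem contDiffOn_transform (hu : ContDiffOn ℝ ∞ u O) (hY : ContDiffOn ℝ ∞ Y O) :
    ContDiffOn ℝ ∞ (transform u Y) O :=
  ((contDiffOn_const.mul hu).mul contDiffOn_const).add
    (((hY.mul contDiffOn_const).sub (contDiffOn_const.mul hY)).mul contDiffOn_const)

theorem smoothSeriesOn_connSeries (hY : ContDiffOn ℝ ∞ Y O) :
    SmoothSeriesOn (fun p => connSeries (Y p)) O := fun m => by
  simp only [connSeries, map_add]
  refine contDiffOn_const.add ?_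
  rcases m with _ | _ | m
  · simpa only [coeff_zero_X_mul] using contDiffOn_const
  · simpa only [coeff_succ_X_mul, coeff_zero_C] using hY
  · simpa only [coeff_succ_X_mul, coeff_succ_C] using contDiffOn_const

theorem flatDefect_connSeries
    (hYx : dx Y p = Y p * u p - transform u Y p * Y p) :
    flatDefect (transform u Y) u (fun q => connSeries (Y q)) p = 0 := by
  have h0 : ∀ y : Mat n, coeff 0 (connSeries y) = aMat n := fun y => by simp [connSeries]
  have h1 : ∀ y : Mat n, coeff 1 (connSeries y) = y := fun y => by
    rw [connSeries, map_add, coeff_C, if_neg one_ne_zero, zero_add, ← zero_add 1,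
      coeff_succ_X_mul, coeff_zero_C]
  have h2 : ∀ (y : Mat n) m, coeff (m + 2) (connSeries y) = 0 := fun y m => by
    rw [connSeries, map_add, coeff_succ_C, coeff_succ_X_mul, coeff_succ_C, add_zero]
  ext1 m
  rcases m with _ | _ | m
  · rw [coeff_zero_flatDefect, h0, sub_self, map_zero]
  · rw [coeff_succ_flatDefect]
    simp only [h0, h1, zero_add]
    rw [dx_const, transform_mul_aMat, map_zero]
    abel
  · rw [coeff_succ_flatDefect]
    simp only [h2]
    rcases m with _ | m
    · simp [h1, hYx]
    · simp [h2, dx_const]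

theorem qSeries_transform_mul [NeZero n] (hO : IsOpen O) (hu : ContDiffOn ℝ ∞ u O)
    (hY : ContDiffOn ℝ ∞ Y O)
    (hYx : ∀ p ∈ O, dx Y p = Y p * u p - transform u Y p * Y p) (hp : p ∈ O) :
    qSeries (transform u Y) p * connSeries (Y p) = connSeries (Y p) * qSeries u p := by
  have hU := contDiffOn_transform hu hY
  have hV := smoothSeriesOn_qSeries hO hu
  have hW := smoothSeriesOn_qSeries hO hU
  have hπ := smoothSeriesOn_connSeries hY
  refine sub_eq_zero.1 <| eq_zero_of_flatDefect_eq_zero (w := transform u Y) (u := u) hO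
    (S := qSeries (transform u Y)) (T := qSeries u)
    (Δ := fun q => qSeries (transform u Y) q * connSeries (Y q) - connSeries (Y q) * qSeries u q)
    (fun q _ => constantCoeff_qSeries) (fun q _ => constantCoeff_qSeries)
    (fun q hq => ?_) (fun q hq => ?_) p hp
  · rw [flatDefect_sub hO (hW.mul hπ) (hπ.mul hV) hq,
      flatDefect_mul hO hW hπ hq (transform u Y), flatDefect_mul hO hπ hV hq u,
      flatDefect_qSeries hO hU hq, flatDefect_qSeries hO hu hq, flatDefect_connSeries (hYx q hq)]
    simp only [zero_mul, mul_zero, add_zero, sub_self]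
  · rw [powDiff_intertwiner, qSeries_pow_self hO hU hq, qSeries_pow_self hO hu hq, one_mul,
      mul_one, sub_self]

theorem Q_transform_relation [NeZero n] (hO : IsOpen O) (hu : ContDiffOn ℝ ∞ u O)
    (hY : ContDiffOn ℝ ∞ Y O)
    (hYx : ∀ p ∈ O, dx Y p = Y p * u p - transform u Y p * Y p) (hp : p ∈ O) (j : ℕ) :
    Q (transform u Y) (j + 1) p * aMat n + Q (transform u Y) j p * Y p =
      aMat n * Q u (j + 1) p + Y p * Q u j p := by
  have h := congrArg (coeff (j + 1)) (qSeries_transform_mul hO hu hY hYx hp)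
  rw [connSeries, mul_add, add_mul, map_add, map_add, coeff_mul_C, coeff_C_mul, mul_assoc X,
    coeff_succ_X_mul, coeff_C_mul, ← mul_assoc, ← X_mul, mul_assoc, coeff_succ_X_mul, coeff_mul_C]
    at h
  simpa only [coeff_qSeries] using h

end Darboux

section TotalSystem

open Filter Metric Set Topology

theorem gronwallBound_one_le {δ K ε : ℝ} (hK : 0 ≤ K) (hε : 0 ≤ ε) :
    gronwallBound δ K ε 1 ≤ (δ + ε) * Real.exp K := by
  obtain rfl | hK0 := hK.eq_or_lt
  · simp [gronwallBound_K0]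
  have hexp : Real.exp K - 1 ≤ K * Real.exp K := by
    have h := mul_le_mul_of_nonneg_right (Real.add_one_le_exp (-K)) (Real.exp_pos K).le
    rw [← Real.exp_add, neg_add_cancel, Real.exp_zero] at h
    linarith
  simp only [gronwallBound_of_K_ne_0 hK0.ne', mul_one, add_mul, div_mul_eq_mul_div, mul_div_assoc]
  gcongr
  exact (div_le_iff₀' hK0).2 hexp

variable {P X : Type*} [NormedAddCommGroup P] [NormedSpace ℝ P] [NormedAddCommGroup X]
  [NormedSpace ℝ X] {s O : Set P} {F G : P → X} {x y : P}

theorem norm_le_of_norm_fderiv_le (hs : Convex ℝ s) {F' : P → P →L[ℝ] X}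
    (hF : ∀ p ∈ s, HasFDerivAt F (F' p) p) {K ε : ℝ} (hK : 0 ≤ K) (hε : 0 ≤ ε)
    (hF' : ∀ p ∈ s, ‖F' p‖ ≤ K * ‖F p‖ + ε) (hx : x ∈ s) (hy : y ∈ s) (hxy : ‖y - x‖ ≤ 1) :
    ‖F y‖ ≤ (‖F x‖ + ε) * Real.exp K := by
  set γ : ℝ → P := fun r => x + r • (y - x) with hγ
  have hmem : ∀ r ∈ Icc (0 : ℝ) 1, γ r ∈ s := fun r hr => hs.add_smul_sub_mem hx hy hr
  have hderiv : ∀ r ∈ Icc (0 : ℝ) 1,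
      HasDerivAt (fun r => F (γ r)) (F' (γ r) (y - x)) r := fun r hr =>
    (hF _ (hmem r hr)).comp_hasDerivAt r <| by
      simpa [hγ] using ((hasDerivAt_id r).smul_const (y - x)).const_add x
  have hbound : ∀ r ∈ Ico (0 : ℝ) 1, ‖F' (γ r) (y - x)‖ ≤ K * ‖F (γ r)‖ + ε := fun r hr =>
    ((F' (γ r)).le_of_opNorm_le_of_le (hF' _ (hmem r (Ico_subset_Icc_self hr))) hxy).trans_eq
      (mul_one _)
  have h := norm_le_gronwallBound_of_norm_deriv_right_le (δ := ‖F x‖)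
    (fun r hr => (hderiv r hr).continuousAt.continuousWithinAt)
    (fun r hr => (hderiv r (Ico_subset_Icc_self hr)).hasDerivWithinAt) (by simp [hγ]) hbound 1
    (by simp)
  have hend : γ 1 = y := by simp [hγ]
  rw [hend, sub_zero] at h
  exact h.trans (gronwallBound_one_le hK hε)

theorem forall_mem_of_isPreconnected {α : Type*} [TopologicalSpace α] {O : Set α}
    (hc : IsPreconnected O) {C : α → Prop}
    (hC : ∀ x ∈ O, ∃ U ∈ 𝓝 x, ∀ y ∈ U, ∀ z ∈ U, C y → C z) {x y : α} (hx : x ∈ O) (hy : y ∈ O)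
    (hCx : C x) : C y := by
  refine hc.induction₂' (fun a b => C a → C b) (fun a ha => ?_)
    (fun _ _ _ _ _ _ hab hbc h => hbc (hab h)) hx hy hCx
  obtain ⟨U, hU, hUC⟩ := hC a ha
  filter_upwards [mem_nhdsWithin_of_mem_nhds hU] with b hb
  exact ⟨hUC a (mem_of_mem_nhds hU) b hb, hUC b hb a (mem_of_mem_nhds hU)⟩

theorem exists_closedBall_subset_of_norm_sub_le_one {P : Type*} [SeminormedAddCommGroup P]
    {O : Set P} (hO : IsOpen O) {x : P} (hx : x ∈ O) :
    ∃ r > 0, closedBall x r ⊆ O ∧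
      ∀ y ∈ closedBall x r, ∀ z ∈ closedBall x r, ‖z - y‖ ≤ 1 := by
  obtain ⟨r, hr, hrO⟩ := nhds_basis_closedBall.mem_iff.1 (hO.mem_nhds hx)
  refine ⟨min r (1 / 2), lt_min hr (by norm_num),
    (closedBall_subset_closedBall (min_le_left _ _)).trans hrO, fun y hy z hz => ?_⟩
  rw [← dist_eq_norm]
  linarith [dist_triangle_right z y x, (mem_closedBall.1 hy).trans (min_le_right _ _),
    (mem_closedBall.1 hz).trans (min_le_right _ _)]

/-- `F` solves on `s` the affine total differential system `dF = θ F + g`, where `θ` is the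
connection form and `g` the inhomogeneity. -/
def SolvesTotalSystem (θ : P → X →L[ℝ] P →L[ℝ] X) (g : P → P →L[ℝ] X) (F : P → X)
    (s : Set P) : Prop :=
  ∀ p ∈ s, HasFDerivAt F (θ p (F p) + g p) p

namespace SolvesTotalSystem

variable {θ θ' : P → X →L[ℝ] P →L[ℝ] X} {g g' : P → P →L[ℝ] X}

theorem mono {t : Set P} (hF : SolvesTotalSystem θ g F t) (hst : s ⊆ t) :
    SolvesTotalSystem θ g F s :=
  fun p hp => hF p (hst hp)

theorem congr (hF : SolvesTotalSystem θ g F s) (hs : IsOpen s) (hG : EqOn G F s) :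
    SolvesTotalSystem θ g G s := fun p hp => by
  rw [hG hp]
  exact (hF p hp).congr_of_eventuallyEq (hG.eventuallyEq_of_mem (hs.mem_nhds hp))

theorem continuousOn (hF : SolvesTotalSystem θ g F s) : ContinuousOn F s :=
  fun p hp => (hF p hp).continuousAt.continuousWithinAt

theorem norm_le (hF : SolvesTotalSystem θ g F s) (hs : Convex ℝ s) {K : ℝ} (hK : 0 ≤ K)
    (hθ : ∀ p ∈ s, ‖θ p‖ ≤ K) (hg : ∀ p ∈ s, ‖g p‖ ≤ K) (hx : x ∈ s) (hy : y ∈ s)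
    (hxy : ‖y - x‖ ≤ 1) : ‖F y‖ ≤ (‖F x‖ + K) * Real.exp K :=
  norm_le_of_norm_fderiv_le hs hF hK hK (fun p hp => (norm_add_le _ _).trans
    (add_le_add ((θ p).le_of_opNorm_le (hθ p hp) _) (hg p hp))) hx hy hxy

theorem norm_sub_le (hF : SolvesTotalSystem θ g F s) (hG : SolvesTotalSystem θ' g' G s)
    (hs : Convex ℝ s) {K M η : ℝ} (hK : 0 ≤ K) (hM : 0 ≤ M) (hη : 0 ≤ η)
    (hθ : ∀ p ∈ s, ‖θ p‖ ≤ K) (hGM : ∀ p ∈ s, ‖G p‖ ≤ M) (hθθ' : ∀ p ∈ s, dist (θ p) (θ' p) ≤ η)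
    (hgg' : ∀ p ∈ s, dist (g p) (g' p) ≤ η) (hx : x ∈ s) (hy : y ∈ s) (hxy : ‖y - x‖ ≤ 1) :
    ‖F y - G y‖ ≤ (‖F x - G x‖ + η * (M + 1)) * Real.exp K := by
  refine norm_le_of_norm_fderiv_le (F := fun p => F p - G p) hs
    (fun p hp => (hF p hp).sub (hG p hp)) hK (by positivity) (fun p hp => ?_) hx hy hxy
  have hsplit : θ p (F p) + g p - (θ' p (G p) + g' p) =
      θ p (F p - G p) + ((θ p - θ' p) (G p) + (g p - g' p)) := by
    rw [map_sub, _root_.sub_apply]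
    abel
  rw [hsplit]
  refine (norm_add_le _ _).trans (add_le_add ((θ p).le_of_opNorm_le (hθ p hp) _)
    ((norm_add_le _ _).trans ?_))
  rw [mul_add, mul_one]
  exact add_le_add ((θ p - θ' p).le_of_opNorm_le_of_le
    ((dist_eq_norm _ _).symm.trans_le (hθθ' p hp)) (hGM p hp))
    ((dist_eq_norm _ _).symm.trans_le (hgg' p hp))

theorem eqOn [ProperSpace P] (hO : IsOpen O) (hc : IsPreconnected O) (hθ : ContinuousOn θ O)
    (hF : SolvesTotalSystem θ g F O) (hG : SolvesTotalSystem θ g G O) (hx : x ∈ O)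
    (h : F x = G x) : EqOn F G O := by
  intro y hy
  refine forall_mem_of_isPreconnected hc (C := fun p => F p = G p) (fun c hcO => ?_) hx hy h
  obtain ⟨r, hr, hrO, hr1⟩ := exists_closedBall_subset_of_norm_sub_le_one hO hcO
  obtain ⟨K, hK⟩ := (isCompact_closedBall c r).exists_bound_of_continuousOn
    (E := X →L[ℝ] P →L[ℝ] X) (hθ.mono hrO)
  obtain ⟨M, hM⟩ := (isCompact_closedBall c r).exists_bound_of_continuousOn
    (hG.continuousOn.mono hrO)
  have hcr : c ∈ closedBall c r := mem_closedBall_self hr.le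
  refine ⟨_, closedBall_mem_nhds c hr, fun a ha b hb hab => sub_eq_zero.1 ?_⟩
  have hle := (hF.mono hrO).norm_sub_le (hG.mono hrO) (convex_closedBall c r)
    ((norm_nonneg _).trans (hK c hcr)) ((norm_nonneg _).trans (hM c hcr)) le_rfl hK hM
    (fun p _ => (dist_self _).le) (fun p _ => (dist_self _).le) ha hb (hr1 a ha b hb)
  simpa [hab] using hle

theorem contDiffOn (hO : IsOpen O) (hθ : ContDiffOn ℝ ∞ θ O) (hg : ContDiffOn ℝ ∞ g O)
    (hF : SolvesTotalSystem θ g F O) : ContDiffOn ℝ ∞ F O := by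
  refine contDiffOn_infty.2 fun m => ?_
  induction m with
  | zero => exact contDiffOn_zero.2 hF.continuousOn
  | succ m ih =>
    rw [Nat.cast_succ, contDiffOn_succ_iff_fderiv_of_isOpen hO]
    refine ⟨fun p hp => (hF p hp).differentiableAt.differentiableWithinAt, by simp, ?_⟩
    exact (((contDiffOn_infty.1 hθ m).clm_apply ih).add (contDiffOn_infty.1 hg m)).congr
      fun p hp => (hF p hp).fderiv

end SolvesTotalSystem

theorem tendstoUniformlyOnFilter_of_tendsto {ι α β : Type*} [TopologicalSpace α] [UniformSpace β]
    {l : Filter ι} {f : ι → α → β} {f₀ : α → β} {c : α} (hf₀ : ContinuousAt f₀ c)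
    (hf : Tendsto (fun q : ι × α => f q.1 q.2) (l ×ˢ 𝓝 c) (𝓝 (f₀ c))) :
    TendstoUniformlyOnFilter f f₀ l (𝓝 c) :=
  tendstoUniformlyOnFilter_iff_tendsto.2 <|
    ((hf₀.tendsto.comp tendsto_snd).prodMk_nhds hf).mono_right (nhds_le_uniformity _)

theorem continuousAt_of_continuousOn_univ_prod {Z α β : Type*} [TopologicalSpace Z]
    [TopologicalSpace α] [TopologicalSpace β] {O : Set α} (hO : IsOpen O) {f : Z → α → β}
    (hf : ContinuousOn (fun q : Z × α => f q.1 q.2) (univ ×ˢ O)) (z : Z) {c : α} (hc : c ∈ O) :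
    ContinuousAt (fun q : Z × α => f q.1 q.2) (z, c) :=
  hf.continuousAt ((isOpen_univ.prod hO).mem_nhds ⟨trivial, hc⟩)

theorem continuousAt_slice {Z α β : Type*} [TopologicalSpace Z]
    [TopologicalSpace α] [TopologicalSpace β] {f : Z → α → β} {z : Z} {c : α}
    (hf : ContinuousAt (fun q : Z × α => f q.1 q.2) (z, c)) : ContinuousAt (f z) c :=
  hf.comp (x := c) (f := fun p => (z, p)) (by fun_prop)

section Parameter

variable {Z : Type*} [TopologicalSpace Z]

theorem tendstoUniformlyOn_of_isCompact {α β : Type*} [TopologicalSpace α] [UniformSpace β]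
    {s : Set α} (hs : IsCompact s) {f : Z → α → β}
    (hf : ContinuousOn (fun q : Z × α => f q.1 q.2) (univ ×ˢ s)) (z₀ : Z) :
    TendstoUniformlyOn f (f z₀) (𝓝 z₀) s := by
  intro U hU
  obtain ⟨V, hV, hVU⟩ := hs.mem_uniformity_of_prod hf (mem_univ z₀) (UniformSpace.symm hU)
  rw [nhdsWithin_univ] at hV
  exact Filter.mem_of_superset hV hVU

theorem eventually_dist_lt_of_isCompact {α β : Type*} [TopologicalSpace α]
    [PseudoMetricSpace β] {z₀ : Z} {l : Filter Z} (hl : l ≤ 𝓝 z₀) {s : Set α} (hs : IsCompact s)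
    {f : Z → α → β} (hf : ContinuousOn (fun q : Z × α => f q.1 q.2) (univ ×ˢ s)) {δ : ℝ}
    (hδ : 0 < δ) : ∀ᶠ m in l ×ˢ l, ∀ p ∈ s, dist (f m.1 p) (f m.2 p) < δ :=
  Filter.Eventually.filter_mono (Filter.prod_mono hl hl) <|
    (tendstoUniformlyOn_of_isCompact hs hf z₀).uniformCauchySeqOn _ (Metric.dist_mem_uniformity hδ)

theorem exists_eventually_norm_le {α E : Type*} [TopologicalSpace α] [SeminormedAddCommGroup E]
    {s : Set α} (hs : IsCompact s) {f : Z → α → E}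
    (hf : ContinuousOn (fun q : Z × α => f q.1 q.2) (univ ×ˢ s)) (z₀ : Z) :
    ∃ K, ∀ᶠ z in 𝓝 z₀, ∀ p ∈ s, ‖f z p‖ ≤ K := by
  obtain ⟨K, hK⟩ := hs.exists_bound_of_continuousOn (f := f z₀)
    (hf.comp (f := fun p => (z₀, p)) (by fun_prop) fun p hp => ⟨trivial, hp⟩)
  refine ⟨K + 1, ?_⟩
  filter_upwards [Metric.tendstoUniformlyOn_iff.1 (tendstoUniformlyOn_of_isCompact hs hf z₀) 1
    one_pos] with z hz p hp
  have hdist := (hz p hp).le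
  rw [dist_eq_norm, norm_sub_rev] at hdist
  linarith [norm_le_norm_add_norm_sub' (f z p) (f z₀ p), hK p hp]

namespace SolvesTotalSystem

variable {z₀ : Z} {l : Filter Z} {θ : Z → P → X →L[ℝ] P →L[ℝ] X} {g : Z → P → P →L[ℝ] X}
  {F : Z → P → X}

theorem exists_eventually_bounds (hl : l ≤ 𝓝 z₀) (hs : Convex ℝ s) (hsc : IsCompact s)
    (hs1 : ∀ y ∈ s, ∀ z ∈ s, ‖z - y‖ ≤ 1)
    (hθ : ContinuousOn (fun q : Z × P => θ q.1 q.2) (univ ×ˢ s))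
    (hg : ContinuousOn (fun q : Z × P => g q.1 q.2) (univ ×ˢ s))
    (hF : ∀ᶠ z in l, SolvesTotalSystem (θ z) (g z) (F z) s) (hx : x ∈ s) {L : X}
    (hL : Tendsto (fun z => F z x) l (𝓝 L)) :
    ∃ K M, 0 ≤ K ∧ 0 ≤ M ∧ ∀ᶠ z in l, (∀ p ∈ s, ‖θ z p‖ ≤ K) ∧ ∀ p ∈ s, ‖F z p‖ ≤ M := by
  obtain ⟨K₁, hK₁⟩ := exists_eventually_norm_le (E := X →L[ℝ] P →L[ℝ] X) hsc hθ z₀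
  obtain ⟨K₂, hK₂⟩ := exists_eventually_norm_le hsc hg z₀
  obtain ⟨K, hK, hK₁K, hK₂K⟩ : ∃ K, 0 ≤ K ∧ K₁ ≤ K ∧ K₂ ≤ K :=
    ⟨max 0 (max K₁ K₂), by simp, by simp, by simp⟩
  refine ⟨K, (‖L‖ + 1 + K) * Real.exp K, hK, by positivity, ?_⟩
  filter_upwards [hF, hl hK₁, hl hK₂, hL.norm.eventually_lt_const (lt_add_one _)]
    with z hFz hθz hgz hLz
  have hθK : ∀ p ∈ s, ‖θ z p‖ ≤ K := fun p hp => (hθz p hp).trans hK₁K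
  refine ⟨hθK, fun p hp => (hFz.norm_le hs hK hθK (fun q hq => (hgz q hq).trans hK₂K) hx hp
    (hs1 x hx p hp)).trans ?_⟩
  gcongr

theorem uniformCauchySeqOn (hl : l ≤ 𝓝 z₀) (hs : Convex ℝ s) (hsc : IsCompact s)
    (hs1 : ∀ y ∈ s, ∀ z ∈ s, ‖z - y‖ ≤ 1)
    (hθ : ContinuousOn (fun q : Z × P => θ q.1 q.2) (univ ×ˢ s))
    (hg : ContinuousOn (fun q : Z × P => g q.1 q.2) (univ ×ˢ s))
    (hF : ∀ᶠ z in l, SolvesTotalSystem (θ z) (g z) (F z) s) (hx : x ∈ s) {L : X}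
    (hL : Tendsto (fun z => F z x) l (𝓝 L)) : UniformCauchySeqOn F l s := by
  obtain ⟨K, M, hK, hM, hKM⟩ := exists_eventually_bounds hl hs hsc hs1 hθ hg hF hx hL
  intro U hU
  obtain ⟨ε, hε, hεU⟩ := Metric.mem_uniformity_dist.1 hU
  set δ := ε / ((M + 3) * Real.exp K) with hδdef
  have hδ : 0 < δ := by positivity
  have hθδ : ∀ᶠ m in l ×ˢ l, ∀ p ∈ s, dist (θ m.1 p) (θ m.2 p) < δ :=
    eventually_dist_lt_of_isCompact (β := X →L[ℝ] P →L[ℝ] X) hl hsc hθ hδ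
  have hgδ : ∀ᶠ m in l ×ˢ l, ∀ p ∈ s, dist (g m.1 p) (g m.2 p) < δ :=
    eventually_dist_lt_of_isCompact hl hsc hg hδ
  have hxδ : ∀ᶠ m in l ×ˢ l, dist (F m.1 x) (F m.2 x) < δ :=
    ((hL.comp tendsto_fst).dist (hL.comp tendsto_snd)).eventually_lt_const (by simpa)
  filter_upwards [(hF.and hKM).prod_mk (hF.and hKM), hθδ, hgδ, hxδ]
    with m ⟨⟨hF₁, hK₁, _⟩, hF₂, _, hM₂⟩ hθm hgm hxm p hp
  apply hεU
  rw [dist_eq_norm] at hxm ⊢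
  calc ‖F m.1 p - F m.2 p‖ ≤ (‖F m.1 x - F m.2 x‖ + δ * (M + 1)) * Real.exp K :=
        hF₁.norm_sub_le hF₂ hs hK hM hδ.le hK₁ hM₂ (fun q hq => (hθm q hq).le)
          (fun q hq => (hgm q hq).le) hx hp (hs1 x hx p hp)
    _ < (δ + δ * (M + 2)) * Real.exp K := by gcongr; linarith
    _ = ε := by rw [hδdef]; field_simp; ring

theorem exists_nhds_uniformCauchySeqOn [ProperSpace P] (hl : l ≤ 𝓝 z₀) (hO : IsOpen O)
    (hθ : ContinuousOn (fun q : Z × P => θ q.1 q.2) (univ ×ˢ O))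
    (hg : ContinuousOn (fun q : Z × P => g q.1 q.2) (univ ×ˢ O))
    (hF : ∀ᶠ z in l, SolvesTotalSystem (θ z) (g z) (F z) O) (hx : x ∈ O) :
    ∃ U ∈ 𝓝 x, U ⊆ O ∧ ∀ y ∈ U, ∀ L, Tendsto (fun z => F z y) l (𝓝 L) →
      UniformCauchySeqOn F l U := by
  obtain ⟨r, hr, hrO, hr1⟩ := exists_closedBall_subset_of_norm_sub_le_one hO hx
  have hsub : (univ : Set Z) ×ˢ closedBall x r ⊆ univ ×ˢ O := prod_mono_right hrO
  exact ⟨_, closedBall_mem_nhds x hr, hrO, fun y hy L hL =>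
    uniformCauchySeqOn hl (convex_closedBall x r) (isCompact_closedBall x r) hr1 (hθ.mono hsub)
      (hg.mono hsub) (hF.mono fun z hz => hz.mono hrO) hy hL⟩

theorem exists_tendsto [ProperSpace P] [CompleteSpace X] [l.NeBot] (hl : l ≤ 𝓝 z₀)
    (hO : IsOpen O) (hc : IsPreconnected O)
    (hθ : ContinuousOn (fun q : Z × P => θ q.1 q.2) (univ ×ˢ O))
    (hg : ContinuousOn (fun q : Z × P => g q.1 q.2) (univ ×ˢ O))
    (hF : ∀ᶠ z in l, SolvesTotalSystem (θ z) (g z) (F z) O) (hx : x ∈ O)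
    (hFx : ∃ L, Tendsto (fun z => F z x) l (𝓝 L)) (hy : y ∈ O) :
    ∃ L, Tendsto (fun z => F z y) l (𝓝 L) := by
  refine forall_mem_of_isPreconnected hc (C := fun p => ∃ L, Tendsto (fun z => F z p) l (𝓝 L))
    (fun p hp => ?_) hx hy hFx
  obtain ⟨U, hU, -, hUC⟩ := exists_nhds_uniformCauchySeqOn hl hO hθ hg hF hp
  exact ⟨U, hU, fun a ha b hb ⟨L, hL⟩ =>
    cauchy_map_iff_exists_tendsto.1 ((hUC a ha L hL).cauchy_map hb)⟩

theorem of_tendsto [ProperSpace P] [l.NeBot] (hl : l ≤ 𝓝 z₀) (hO : IsOpen O)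
    (hθ : ContinuousOn (fun q : Z × P => θ q.1 q.2) (univ ×ˢ O))
    (hg : ContinuousOn (fun q : Z × P => g q.1 q.2) (univ ×ˢ O))
    (hF : ∀ᶠ z in l, SolvesTotalSystem (θ z) (g z) (F z) O) {F₀ : P → X}
    (hF₀ : ∀ p ∈ O, Tendsto (fun z => F z p) l (𝓝 (F₀ p))) :
    SolvesTotalSystem (θ z₀) (g z₀) F₀ O := by
  intro c hcO
  obtain ⟨U, hU, hUO, hUC⟩ := exists_nhds_uniformCauchySeqOn hl hO hθ hg hF hcO
  have hunif : TendstoUniformlyOn F F₀ l U :=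
    (hUC c (mem_of_mem_nhds hU) _ (hF₀ c hcO)).tendstoUniformlyOn_of_tendsto
      fun p hp => hF₀ p (hUO hp)
  have hF₀c : ContinuousAt F₀ c :=
    (hunif.continuousOn (hF.mono fun z hz => (hz.mono hUO).continuousOn).frequently).continuousAt hU
  have hFc : Tendsto (fun q : Z × P => F q.1 q.2) (l ×ˢ 𝓝 c) (𝓝 (F₀ c)) :=
    (hF₀c.tendsto.comp tendsto_snd).congr_uniformity <| tendstoUniformlyOnFilter_iff_tendsto.1
      (hunif.tendstoUniformlyOnFilter.mono_right (le_principal_iff.2 hU))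
  have hprod : l ×ˢ 𝓝 c ≤ 𝓝 (z₀, c) := by
    rw [nhds_prod_eq]
    exact Filter.prod_mono_left _ hl
  have hθc : ContinuousAt (fun q : Z × P => θ q.1 q.2) (z₀, c) :=
    continuousAt_of_continuousOn_univ_prod (f := θ) hO hθ z₀ hcO
  have hgc : ContinuousAt (fun q : Z × P => g q.1 q.2) (z₀, c) :=
    continuousAt_of_continuousOn_univ_prod hO hg z₀ hcO
  exact hasFDerivAt_of_tendstoUniformlyOnFilter
    (f' := fun z p => θ z p (F z p) + g z p) (g' := fun p => θ z₀ p (F₀ p) + g z₀ p)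
    (tendstoUniformlyOnFilter_of_tendsto
      (((continuousAt_slice (f := θ) hθc).clm_apply hF₀c).add (continuousAt_slice hgc))
      (((isBoundedBilinearMap_apply.continuous.tendsto (θ z₀ c, F₀ c)).comp
        ((hθc.tendsto.mono_left hprod).prodMk_nhds hFc)).add
        (hgc.tendsto.mono_left hprod)))
    ((hF.prod_mk (hO.mem_nhds hcO)).mono fun q hq => hq.1 q.2 hq.2)
    (Filter.eventually_of_mem (hO.mem_nhds hcO) hF₀)

/- The difference quotient in `z` solves the same system with inhomogeneity `σ F`, so its
convergence propagates from one point to the whole domain. -/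
theorem differentiableAt_param [ProperSpace P] {X : Type*} [NormedAddCommGroup X]
    [NormedSpace ℂ X] [CompleteSpace X] {θ σ : ℂ → P → X →L[ℝ] P →L[ℝ] X} {F : ℂ → P → X}
    {z₀ : ℂ} (hO : IsOpen O) (hc : IsPreconnected O)
    (hθ : ContinuousOn (fun q : ℂ × P => θ q.1 q.2) (univ ×ˢ O))
    (hσ : ContinuousOn (fun q : ℂ × P => σ q.1 q.2) (univ ×ˢ O))
    (hθσ : ∀ z p v, θ z p v = θ z₀ p v + (z - z₀) • σ z p v)
    (hθ_smul : ∀ (c : ℂ) z p v, θ z p (c • v) = c • θ z p v)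
    (hF : ∀ z, SolvesTotalSystem (θ z) 0 (F z) O) (hx : x ∈ O)
    (hFx : DifferentiableAt ℂ (fun z => F z x) z₀) (hy : y ∈ O) :
    DifferentiableAt ℂ (fun z => F z y) z₀ := by
  have hslope : ∀ᶠ z in 𝓝[≠] z₀, SolvesTotalSystem (θ z) (fun p => σ z p (F z₀ p))
      (fun p => slope (fun z => F z p) z₀ z) O := by
    filter_upwards [self_mem_nhdsWithin] with z hz p hp
    convert! ((hF z p hp).sub (hF z₀ p hp)).const_smul (z - z₀)⁻¹ using 1
    simp only [slope, vsub_eq_sub, hθ_smul, Pi.zero_apply, add_zero, map_sub]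
    rw [hθσ z p (F z₀ p), ← sub_sub, smul_sub _ _ ((z - z₀) • _),
      inv_smul_smul₀ (sub_ne_zero.2 hz), sub_add_cancel, smul_sub]
  have hg : ContinuousOn (fun q : ℂ × P => σ q.1 q.2 (F z₀ q.2)) (univ ×ˢ O) :=
    hσ.clm_apply ((hF z₀).continuousOn.comp continuousOn_snd fun q hq => hq.2)
  obtain ⟨L, hL⟩ := exists_tendsto nhdsWithin_le_nhds hO hc hθ hg hslope hx
    ⟨_, hasDerivAt_iff_tendsto_slope.1 hFx.hasDerivAt⟩ hy
  exact (hasDerivAt_iff_tendsto_slope.2 hL).differentiableAt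

end SolvesTotalSystem

end Parameter

end TotalSystem

section LaxPair

open Set

theorem SolvesTotalSystem.map {P X X' : Type*} [NormedAddCommGroup P] [NormedSpace ℝ P]
    [NormedAddCommGroup X] [NormedSpace ℝ X] [NormedAddCommGroup X'] [NormedSpace ℝ X']
    {θ : P → X →L[ℝ] P →L[ℝ] X} {θ' : P → X' →L[ℝ] P →L[ℝ] X'} {F : P → X} {s : Set P}
    (hF : SolvesTotalSystem θ 0 F s) (φ : X →L[ℝ] X')
    (hφ : ∀ p ∈ s, ∀ x h, φ (θ p x h) = θ' p (φ x) h) :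
    SolvesTotalSystem θ' 0 (fun p => φ (F p)) s := fun p hp => by
  refine (φ.hasFDerivAt.comp p (hF p hp)).congr_fderiv (ContinuousLinearMap.ext fun h => ?_)
  simpa using hφ p hp (F p) h

theorem SolvesTotalSystem.zero {P X : Type*} [NormedAddCommGroup P] [NormedSpace ℝ P]
    [NormedAddCommGroup X] [NormedSpace ℝ X] {θ : P → X →L[ℝ] P →L[ℝ] X} {s : Set P} :
    SolvesTotalSystem θ 0 (fun _ => 0) s := fun p _ => by
  simpa using hasFDerivAt_const (𝕜 := ℝ) (0 : X) p

section RightMultiplication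

variable {R : Type*} [NormedRing R] [NormedAlgebra ℂ R]

/-- The connection form of the linear system `F_x = F M`, `F_t = F N`. -/
noncomputable def rightForm (M N : R) : R →L[ℝ] ℝ × ℝ →L[ℝ] R :=
  ContinuousLinearMap.smulRightL ℝ (ℝ × ℝ) R (.fst ℝ ℝ ℝ) ∘L (ContinuousLinearMap.mul ℝ R).flip M +
    ContinuousLinearMap.smulRightL ℝ (ℝ × ℝ) R (.snd ℝ ℝ ℝ) ∘L (ContinuousLinearMap.mul ℝ R).flip N

theorem rightForm_apply (M N x : R) (h : ℝ × ℝ) :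
    rightForm M N x h = h.1 • (x * M) + h.2 • (x * N) := rfl

theorem contDiffOn_rightForm {P : Type*} [NormedAddCommGroup P] [NormedSpace ℝ P] {O : Set P}
    {M N : P → R} (hM : ContDiffOn ℝ ∞ M O) (hN : ContDiffOn ℝ ∞ N O) :
    ContDiffOn ℝ ∞ (fun p => rightForm (M p) (N p)) O :=
  (contDiffOn_const.clm_comp ((ContinuousLinearMap.mul ℝ R).flip.contDiff.comp_contDiffOn hM)).add
    (contDiffOn_const.clm_comp ((ContinuousLinearMap.mul ℝ R).flip.contDiff.comp_contDiffOn hN))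

theorem continuousOn_rightForm {P : Type*} [TopologicalSpace P] {O : Set P} {M N : P → R}
    (hM : ContinuousOn M O) (hN : ContinuousOn N O) :
    ContinuousOn (fun p => rightForm (M p) (N p)) O :=
  (continuousOn_const.clm_comp
    ((ContinuousLinearMap.mul ℝ R).flip.continuous.comp_continuousOn hM)).add
  (continuousOn_const.clm_comp
    ((ContinuousLinearMap.mul ℝ R).flip.continuous.comp_continuousOn hN))

theorem hasFDerivAt_rightForm_iff {f : ℝ × ℝ → R} {f' : ℝ × ℝ →L[ℝ] R} {p : ℝ × ℝ} {M N : R}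
    (hf : HasFDerivAt f f' p) :
    HasFDerivAt f (rightForm M N (f p)) p ↔ f' (1, 0) = f p * M ∧ f' (0, 1) = f p * N := by
  refine ⟨fun h => ?_, fun ⟨hx, ht⟩ => hf.congr_fderiv (ContinuousLinearMap.ext fun h => ?_)⟩
  · simp [hf.unique h, rightForm_apply]
  · obtain ⟨r, s⟩ := h
    have hrs : (r, s) = r • ((1, 0) : ℝ × ℝ) + s • ((0, 1) : ℝ × ℝ) := by simp
    rw [hrs, map_add, map_smul, map_smul, hx, ht]
    simp [rightForm_apply]

variable {P : Type*} {O : Set P} {a : R} {u : P → R} {q : ℕ → P → R} {N : ℕ} {p : P}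

/-- The coefficient `∑ q_j λ ^ (N-j)` of the `t`-equation of a Lax pair. -/
noncomputable def laxSum (q : ℕ → P → R) (N : ℕ) (z : ℂ) (p : P) : R :=
  ∑ j ∈ Finset.range (N + 1), z ^ (N - j) • q j p

/-- The connection form of the Lax pair `F_x = F (a λ + u)`, `F_t = F ∑ q_j λ ^ (N-j)`. -/
noncomputable def laxForm (a : R) (u : P → R) (q : ℕ → P → R) (N : ℕ) (z : ℂ) (p : P) :
    R →L[ℝ] ℝ × ℝ →L[ℝ] R :=
  rightForm (z • a + u p) (laxSum q N z p)

theorem contDiffOn_laxForm [NormedAddCommGroup P] [NormedSpace ℝ P] (hu : ContDiffOn ℝ ∞ u O)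
    (hq : ∀ j, ContDiffOn ℝ ∞ (q j) O) (z : ℂ) : ContDiffOn ℝ ∞ (laxForm a u q N z) O :=
  contDiffOn_rightForm (contDiffOn_const.add hu)
    (ContDiffOn.sum fun j _ => (hq j).const_smul (z ^ (N - j)))

theorem continuousOn_laxForm [TopologicalSpace P] (hu : ContinuousOn u O)
    (hq : ∀ j, ContinuousOn (q j) O) :
    ContinuousOn (fun r : ℂ × P => laxForm a u q N r.1 r.2) (univ ×ˢ O) := by
  have hsnd : MapsTo Prod.snd ((univ : Set ℂ) ×ˢ O) O := fun r hr => hr.2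
  have hA : ContinuousOn (fun r : ℂ × P => r.1 • a + u r.2) (univ ×ˢ O) :=
    (continuous_fst.smul continuous_const).continuousOn.add (hu.comp continuousOn_snd hsnd)
  have hV : ContinuousOn (fun r : ℂ × P => laxSum q N r.1 r.2) (univ ×ˢ O) :=
    continuousOn_finsetSum _ fun j _ => (continuous_fst.pow _).continuousOn.smul
      ((hq j).comp continuousOn_snd hsnd)
  exact continuousOn_rightForm hA hV

/-- The divided difference of `laxForm` in the spectral parameter. -/
noncomputable def laxFormSlope (a : R) (q : ℕ → P → R) (N : ℕ) (z₀ z : ℂ) (p : P) :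
    R →L[ℝ] ℝ × ℝ →L[ℝ] R :=
  rightForm a (∑ j ∈ Finset.range (N + 1),
    (∑ i ∈ Finset.range (N - j), z ^ i * z₀ ^ (N - j - 1 - i)) • q j p)

theorem continuousOn_laxFormSlope [TopologicalSpace P] (hq : ∀ j, ContinuousOn (q j) O) (z₀ : ℂ) :
    ContinuousOn (fun r : ℂ × P => laxFormSlope a q N z₀ r.1 r.2) (univ ×ˢ O) :=
  continuousOn_rightForm continuousOn_const <| continuousOn_finsetSum _ fun j _ =>
    ContinuousOn.smul (by fun_prop) ((hq j).comp continuousOn_snd fun _ hr => hr.2)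

theorem laxForm_eq_add_smul (z₀ z : ℂ) (y : R) :
    laxForm a u q N z p y = laxForm a u q N z₀ p y + (z - z₀) • laxFormSlope a q N z₀ z p y := by
  have hA : z • a + u p = z₀ • a + u p + (z - z₀) • a := by
    rw [sub_smul]
    abel
  have hV : laxSum q N z p = laxSum q N z₀ p + (z - z₀) • ∑ j ∈ Finset.range (N + 1),
      (∑ i ∈ Finset.range (N - j), z ^ i * z₀ ^ (N - j - 1 - i)) • q j p := by
    simp only [laxSum, Finset.smul_sum, smul_smul, ← Finset.sum_add_distrib, ← add_smul]
    refine Finset.sum_congr rfl fun j _ => ?_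
    rw [mul_comm, geom_sum₂_mul, add_sub_cancel]
  refine ContinuousLinearMap.ext fun h => ?_
  simp only [laxForm, laxFormSlope, hA, hV, rightForm_apply, _root_.add_apply, _root_.smul_apply,
    mul_add, mul_smul_comm, smul_add, smul_comm _ (z - z₀)]
  abel

theorem laxForm_smul (c z : ℂ) (y : R) :
    laxForm a u q N z p (c • y) = c • laxForm a u q N z p y :=
  ContinuousLinearMap.ext fun h => by
    simp only [laxForm, rightForm_apply, _root_.smul_apply, smul_mul_assoc, smul_add, smul_comm _ c]

end RightMultiplication

end LaxPair

section Trivialization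

attribute [local instance] Matrix.linftyOpNormedRing Matrix.linftyOpNormedAlgebra

variable {n : ℕ} {O : Set (ℝ × ℝ)} {u : ℝ × ℝ → Mat n} {E : ℝ × ℝ → ℂ → Mat n} {p : ℝ × ℝ}

theorem solvesTotalSystem_laxForm_iff {f : ℝ × ℝ → Mat n} (hO : IsOpen O) (hf : ContDiffOn ℝ ∞ f O)
    {a : Mat n} {q : ℕ → ℝ × ℝ → Mat n} {N : ℕ} {z : ℂ} :
    SolvesTotalSystem (laxForm a u q N z) 0 f O ↔
      ∀ p ∈ O, dx f p = f p * (z • a + u p) ∧ dt f p = f p * laxSum q N z p := by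
  refine forall₂_congr fun p hp => ?_
  rw [dx_eq_fderiv hO hf hp, dt_eq_fderiv hO hf hp, Pi.zero_apply, add_zero]
  exact hasFDerivAt_rightForm_iff (hasFDerivAt_of_contDiffOn hO hf hp)

namespace IsTrivialization

theorem solvesTotalSystem (hO : IsOpen O) (hE : IsTrivialization n O u E) (z : ℂ) :
    SolvesTotalSystem (laxForm (aMat n) u (Q u) (n + 1) z) 0 (fun p => E p z) O :=
  (solvesTotalSystem_laxForm_iff hO (hE.smooth z)).2 fun p hp => ⟨hE.eqn_x z p hp, hE.eqn_t z p hp⟩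

theorem isUnit_det (hO : IsOpen O) (hc : IsPreconnected O) (h0 : (0, 0) ∈ O)
    (hu : ContDiffOn ℝ ∞ u O) (hE : IsTrivialization n O u E) (hp : p ∈ O) (z : ℂ) :
    IsUnit (E p z).det := by
  rw [isUnit_iff_ne_zero]
  intro hdet
  obtain ⟨c, hc0, hcE⟩ := Matrix.exists_vecMul_eq_zero_iff.2 hdet
  set D : Mat n := Matrix.of fun _ => c
  have hDE : D * E p z = 0 := Matrix.ext fun _ j => congrFun hcE j
  have hsolves : SolvesTotalSystem (laxForm (aMat n) u (Q u) (n + 1) z) 0 (fun q => D * E q z) O :=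
    (hE.solvesTotalSystem hO z).map (ContinuousLinearMap.mul ℝ (Mat n) D) fun q _ y h => by
      simp only [laxForm, rightForm_apply, ContinuousLinearMap.mul_apply', mul_add, mul_assoc,
        mul_smul_comm]
  have hzero : SolvesTotalSystem (laxForm (aMat n) u (Q u) (n + 1) z) 0 (fun _ => (0 : Mat n)) O :=
    .zero
  have hD : D * E (0, 0) z = 0 :=
    SolvesTotalSystem.eqOn hO hc (contDiffOn_laxForm hu (contDiffOn_Q hO hu) z).continuousOn hsolves
      hzero hp hDE h0
  rw [hE.normalized, mul_one] at hD
  obtain ⟨i, hi⟩ := Function.ne_iff.1 hc0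
  exact hi (congrFun (congrFun hD i) i)

theorem differentiable (hO : IsOpen O) (hc : IsPreconnected O) (h0 : (0, 0) ∈ O)
    (hu : ContDiffOn ℝ ∞ u O) (hE : IsTrivialization n O u E) (hp : p ∈ O) :
    Differentiable ℂ (E p) := fun z₀ =>
  SolvesTotalSystem.differentiableAt_param (F := fun z p => E p z) hO hc
    (continuousOn_laxForm hu.continuousOn fun j => (contDiffOn_Q hO hu j).continuousOn)
    (continuousOn_laxFormSlope (fun j => (contDiffOn_Q hO hu j).continuousOn) z₀)
    (fun z _ v => laxForm_eq_add_smul z₀ z v) (fun c z _ v => laxForm_smul c z v)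
    (hE.solvesTotalSystem hO) h0 (by simp [hE.normalized]) hp

variable [NeZero n]

theorem apply_root_mul (hO : IsOpen O) (hc : IsPreconnected O) (h0 : (0, 0) ∈ O)
    (hu : ContDiffOn ℝ ∞ u O) (hτ : ∀ p ∈ O, cycConj n (u p) = u p)
    (hE : IsTrivialization n O u E) (hp : p ∈ O) (z : ℂ) :
    E p (root n * z) = cycConj n (E p z) := by
  have hroot : root n ^ (n + 1) = root n := by rw [pow_succ, root_pow_self, one_mul]
  have hA : ∀ q ∈ O, cycConj n (z • aMat n + u q) = (root n * z) • aMat n + u q := fun q hq => by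
    rw [map_add, hτ q hq, map_smul, cycConj_aMat, smul_smul, mul_comm]
  have hV : ∀ q ∈ O,
      cycConj n (laxSum (Q u) (n + 1) z q) = laxSum (Q u) (n + 1) (root n * z) q := fun q hq => by
    rw [laxSum, laxSum, map_sum]
    refine Finset.sum_congr rfl fun j hj => ?_
    rw [map_smul, cycConj_Q hO hu hτ (Nat.lt_succ_iff.1 (Finset.mem_range.1 hj)) hroot hq,
      smul_smul, mul_pow, mul_comm]
  let φ : Mat n →ₗ[ℝ] Mat n := (cycConj n).toLinearMap.restrictScalars ℝ
  have hconj : SolvesTotalSystem (laxForm (aMat n) u (Q u) (n + 1) (root n * z)) 0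
      (fun q => cycConj n (E q z)) O :=
    (hE.solvesTotalSystem hO z).map φ.toContinuousLinearMap fun q hq y h => by
      change φ (h.1 • (y * _) + h.2 • (y * _)) = h.1 • (cycConj n y * _) + h.2 • (cycConj n y * _)
      rw [map_add, map_smul, map_smul, ← hA q hq, ← hV q hq, ← map_mul, ← map_mul]
      rfl
  exact SolvesTotalSystem.eqOn hO hc (contDiffOn_laxForm hu (contDiffOn_Q hO hu) _).continuousOn
    (hE.solvesTotalSystem hO _) hconj h0 (by simp [hE.normalized]) hp

theorem apply_root_pow_mul (hO : IsOpen O) (hc : IsPreconnected O) (h0 : (0, 0) ∈ O)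
    (hu : ContDiffOn ℝ ∞ u O) (hτ : ∀ p ∈ O, cycConj n (u p) = u p)
    (hE : IsTrivialization n O u E) (hp : p ∈ O) (z : ℂ) (j : ℕ) :
    E p (root n ^ j * z) = (cycConj n)^[j] (E p z) := by
  induction j with
  | zero => simp
  | succ j ih =>
    rw [Function.iterate_succ_apply', ← ih, pow_succ', mul_assoc,
      hE.apply_root_mul hO hc h0 hu hτ hp]

end IsTrivialization

end Trivialization

section Evolution

attribute [local instance] Matrix.linftyOpNormedRing Matrix.linftyOpNormedAlgebra

theorem sum_range_succ_mul_pow {R : Type*} [Semiring R] (x : R) (c : ℕ → R) (N : ℕ) :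
    ∑ j ∈ Finset.range (N + 2), c j * x ^ (N + 1 - j) =
      (∑ j ∈ Finset.range (N + 1), c j * x ^ (N - j)) * x + c (N + 1) := by
  rw [Finset.sum_range_succ, Nat.sub_self, pow_zero, mul_one, Finset.sum_mul]
  congr 1
  refine Finset.sum_congr rfl fun j hj => ?_
  rw [mul_assoc, ← pow_succ, Nat.sub_add_comm (Nat.lt_succ_iff.1 (Finset.mem_range.1 hj))]

/- For `x = λ` this is the gauge identity between the `t`-equations of the two Lax pairs; for a
root `x` of `a x + Y` it is the `t`-equation of the Bäcklund system. -/
theorem gauge_telescope {R : Type*} [Ring R] {a Y : R} (x : R) {q qt : ℕ → R} (h0 : q 0 = a)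
    (ht0 : qt 0 = a) {N : ℕ}
    (hrel : ∀ j < N, qt (j + 1) * a + qt j * Y = a * q (j + 1) + Y * q j) :
    a * (∑ j ∈ Finset.range (N + 1), q j * x ^ (N - j)) * x +
        Y * (∑ j ∈ Finset.range (N + 1), q j * x ^ (N - j)) =
      ∑ j ∈ Finset.range (N + 1), qt j * (a * x + Y) * x ^ (N - j) + (Y * q N - qt N * Y) := by
  induction N with
  | zero =>
    simp only [zero_add, Finset.range_one, Finset.sum_singleton, Nat.sub_self, pow_zero, mul_one,
      h0, ht0]
    noncomm_ring
  | succ N ih =>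
    have hN := ih fun j hj => hrel j (Nat.lt_succ_of_lt hj)
    rw [sum_range_succ_mul_pow, sum_range_succ_mul_pow x fun j => qt j * (a * x + Y)]
    set H := ∑ j ∈ Finset.range (N + 1), q j * x ^ (N - j)
    set T := ∑ j ∈ Finset.range (N + 1), qt j * (a * x + Y) * x ^ (N - j)
    calc a * (H * x + q (N + 1)) * x + Y * (H * x + q (N + 1))
        = (a * H * x + Y * H) * x + (a * q (N + 1) + Y * q N) * x - Y * q N * x +
            Y * q (N + 1) := by noncomm_ring
      _ = T * x + qt (N + 1) * (a * x + Y) + (Y * q (N + 1) - qt (N + 1) * Y) := by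
        rw [hN, ← hrel N N.lt_succ_self]
        noncomm_ring

variable {n : ℕ}

theorem hasDerivAt_mat_inv {f : ℝ → Mat n} {f' : Mat n} {s : ℝ} (hf : HasDerivAt f f' s)
    (h : IsUnit (f s).det) : HasDerivAt (fun t => (f t)⁻¹) (-((f s)⁻¹ * f' * (f s)⁻¹)) s := by
  obtain ⟨U, hU⟩ := (Matrix.isUnit_iff_isUnit_det _).2 h
  have hinv := hasFDerivAt_ringInverse (𝕜 := ℝ) U
  rw [← Ring.inverse_unit, hU] at hinv
  simp only [Matrix.nonsing_inv_eq_ringInverse]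
  exact hinv.comp_hasDerivAt s hf

theorem contDiffOn_mat_inv {P : Type*} [NormedAddCommGroup P] [NormedSpace ℝ P] {s : Set P}
    {f : P → Mat n} (hf : ContDiffOn ℝ ∞ f s) (h : ∀ p ∈ s, IsUnit (f p).det) :
    ContDiffOn ℝ ∞ (fun p => (f p)⁻¹) s := by
  intro p hp
  obtain ⟨U, hU⟩ := (Matrix.isUnit_iff_isUnit_det _).2 (h p hp)
  have hinv := contDiffAt_ringInverse (n := ∞) ℝ U
  rw [hU] at hinv
  simp only [Matrix.nonsing_inv_eq_ringInverse]
  exact hinv.comp_contDiffWithinAt p (hf p hp)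

/-- The linear map `y ↦ B(y v)`. -/
noncomputable def bOrbit (v : Fin n → ℂ) : Mat n →ₗ[ℂ] Mat n where
  toFun y := B (y *ᵥ v)
  map_add' y z := by
    ext i j
    simp [B, Matrix.add_mulVec, Matrix.mulVec_add]
  map_smul' c y := by
    ext i j
    simp [B, Matrix.smul_mulVec, Matrix.mulVec_smul]

theorem bOrbit_apply (v : Fin n → ℂ) (y : Mat n) : bOrbit v y = B (y *ᵥ v) := rfl

theorem hasDerivAt_bOrbit {f : ℝ → Mat n} {f' : Mat n} {s : ℝ} (hf : HasDerivAt f f' s)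
    (v : Fin n → ℂ) : HasDerivAt (fun t => bOrbit v (f t)) (bOrbit v f') s :=
  ((bOrbit v).restrictScalars ℝ).toContinuousLinearMap.hasFDerivAt.comp_hasDerivAt s hf

theorem contDiffOn_bOrbit {P : Type*} [NormedAddCommGroup P] [NormedSpace ℝ P]
    {s : Set P} {f : P → Mat n} (hf : ContDiffOn ℝ ∞ f s) (v : Fin n → ℂ) :
    ContDiffOn ℝ ∞ (fun p => bOrbit v (f p)) s :=
  ((bOrbit v).restrictScalars ℝ).toContinuousLinearMap.contDiff.comp_contDiffOn hf

/-- The matrix `k B(w) a B(w)⁻¹`, whose eigenvalue on the line of `τ^{-j} w` is `k α ^ j`. -/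
noncomputable def poleMat (w : Fin n → ℂ) (k : ℂ) : Mat n := k • (B w * aMat n * (B w)⁻¹)

variable {w : Fin n → ℂ} {k : ℂ}

theorem Ymat_eq : Ymat w k = -(aMat n * poleMat w k) := by
  rw [Ymat, poleMat, Matrix.mul_smul, ← Matrix.mul_assoc, ← Matrix.mul_assoc]

theorem poleMat_mul_B (hw : IsUnit (B w).det) : poleMat w k * B w = k • (B w * aMat n) := by
  rw [poleMat, Matrix.smul_mul, Matrix.nonsing_inv_mul_cancel_right _ _ hw]

theorem poleMat_pow_mul_B (hw : IsUnit (B w).det) (e : ℕ) :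
    poleMat w k ^ e * B w = k ^ e • (B w * aMat n ^ e) := by
  induction e with
  | zero => simp
  | succ e ih =>
    rw [pow_succ, Matrix.mul_assoc, poleMat_mul_B hw, Matrix.mul_smul, ← Matrix.mul_assoc, ih,
      Matrix.smul_mul, smul_smul, pow_succ, pow_succ, Matrix.mul_assoc, mul_comm k]

theorem cycConj_Ymat [NeZero n] (hw : IsUnit (B w).det) :
    cycConj n (Ymat w k) = Ymat w k := by
  have hB : cycConj n (B w) = B w * tau n * tau n := by rw [← tau_inv_mul_mul_tau, tau_inv_mul_B]
  have hτa : aMat n * tau n = root n • (tau n * aMat n) := by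
    rw [← Matrix.mul_smul, ← cycConj_aMat, ← tau_inv_mul_mul_tau, Matrix.mul_assoc (tau n)⁻¹,
      Matrix.mul_nonsing_inv_cancel_left _ _ isUnit_det_tau]
  have hττa : root n • (tau n * (root n • (tau n * aMat n))) = aMat n * tau n * tau n := by
    rw [← hτa, ← Matrix.mul_assoc, ← Matrix.smul_mul, ← hτa]
  have hYB : Ymat w k * B w = -(k • (aMat n * (B w * aMat n))) := by
    rw [Ymat_eq, neg_mul, Matrix.mul_assoc, poleMat_mul_B hw, Matrix.mul_smul]
  have hunit : IsUnit (cycConj n (B w)) := ((Matrix.isUnit_iff_isUnit_det _).2 hw).map (cycConj n)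
  refine hunit.mul_right_cancel ?_
  calc cycConj n (Ymat w k) * cycConj n (B w)
      = -(k • (aMat n * (B w * (root n • (tau n * (root n • (tau n * aMat n))))))) := by
        rw [← map_mul, hYB]
        simp only [map_neg, map_smul, map_mul, cycConj_aMat, hB, Matrix.smul_mul, Matrix.mul_smul,
          Matrix.mul_assoc]
    _ = Ymat w k * cycConj n (B w) := by
        rw [hττa, hB, ← Matrix.mul_assoc (Ymat w k), ← Matrix.mul_assoc (Ymat w k), hYB]
        simp only [neg_mul, Matrix.smul_mul, Matrix.mul_assoc]

theorem B_sum_mulVec [NeZero n] {q : ℕ → Mat n} {N : ℕ}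
    (hq : ∀ j ≤ N, cycConj n (q j) = root n ^ (N - j) • q j) (hw : IsUnit (B w).det) :
    B ((∑ j ∈ Finset.range (N + 1), k ^ (N - j) • q j) *ᵥ w) =
      (∑ j ∈ Finset.range (N + 1), q j * poleMat w k ^ (N - j)) * B w := by
  rw [← bOrbit_apply, map_sum, Finset.sum_mul]
  refine Finset.sum_congr rfl fun j hj => ?_
  rw [map_smul, bOrbit_apply, B_mulVec (hq j (Nat.lt_succ_iff.1 (Finset.mem_range.1 hj))),
    Matrix.mul_assoc (q j) (poleMat w k ^ _), poleMat_pow_mul_B hw, Matrix.mul_smul,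
    Matrix.mul_assoc]

theorem hasDerivAt_poleMat {f : ℝ → Mat n} {C H : Mat n} {s : ℝ}
    (hf : HasDerivAt f (f s * C) s) (hfs : IsUnit (f s).det) {v : Fin n → ℂ}
    (hvw : (f s)⁻¹ *ᵥ v = w) (hw : IsUnit (B w).det) (hC : B (C *ᵥ w) = H * B w) :
    HasDerivAt (fun r => poleMat ((f r)⁻¹ *ᵥ v) k) (poleMat w k * H - H * poleMat w k) s := by
  have hB : HasDerivAt (fun r => B ((f r)⁻¹ *ᵥ v)) (-(H * B w)) s := by
    have hfinv : (f s)⁻¹ * (f s * C) * (f s)⁻¹ = C * (f s)⁻¹ := by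
      rw [Matrix.nonsing_inv_mul_cancel_left _ _ hfs]
    have h := hasDerivAt_bOrbit (hasDerivAt_mat_inv hf hfs) v
    rwa [hfinv, map_neg, bOrbit_apply, ← Matrix.mulVec_mulVec, hvw, hC] at h
  have hBinv := hasDerivAt_mat_inv hB (by rwa [hvw])
  refine (((hB.mul_const (aMat n)).mul hBinv).const_smul k).congr_deriv ?_
  have hcancel : (B w)⁻¹ * -(H * B w) * (B w)⁻¹ = -((B w)⁻¹ * H) := by
    rw [mul_neg, neg_mul, ← Matrix.mul_assoc, Matrix.mul_nonsing_inv_cancel_right _ _ hw]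
  rw [hvw, hcancel, poleMat]
  simp only [neg_neg, neg_mul, smul_add, smul_neg, Matrix.smul_mul, Matrix.mul_smul,
    Matrix.mul_assoc]
  rw [← sub_eq_neg_add]

theorem hasDerivAt_Ymat [NeZero n] {f : ℝ → Mat n} {q qt : ℕ → Mat n} {N : ℕ} {s : ℝ}
    (hf : HasDerivAt f (f s * ∑ j ∈ Finset.range (N + 1), k ^ (N - j) • q j) s)
    (hfs : IsUnit (f s).det) {v : Fin n → ℂ} (hvw : (f s)⁻¹ *ᵥ v = w) (hw : IsUnit (B w).det)
    (hq : ∀ j ≤ N, cycConj n (q j) = root n ^ (N - j) • q j)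
    (h0 : q 0 = aMat n) (ht0 : qt 0 = aMat n)
    (hrel : ∀ j < N,
      qt (j + 1) * aMat n + qt j * Ymat w k = aMat n * q (j + 1) + Ymat w k * q j) :
    HasDerivAt (fun r => Ymat ((f r)⁻¹ *ᵥ v) k) (Ymat w k * q N - qt N * Ymat w k) s := by
  have hpole := hasDerivAt_poleMat (k := k) hf hfs hvw hw (B_sum_mulVec hq hw)
  simp only [Ymat_eq (w := (f _)⁻¹ *ᵥ v)]
  refine (hpole.const_mul (aMat n)).neg.congr_deriv ?_
  have htel := gauge_telescope (poleMat w k) h0 ht0 hrel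
  have hroot : aMat n * poleMat w k + Ymat w k = 0 := by rw [Ymat_eq, add_neg_cancel]
  simp only [hroot, mul_zero, zero_mul, Finset.sum_const_zero, zero_add] at htel
  rw [← htel, Ymat_eq]
  noncomm_ring

end Evolution

section Backlund

attribute [local instance] Matrix.linftyOpNormedRing Matrix.linftyOpNormedAlgebra

variable {n : ℕ} {O O₁ : Set (ℝ × ℝ)} {u Y : ℝ × ℝ → Mat n} {E : ℝ × ℝ → ℂ → Mat n} {k : ℂ}
  {v : Fin n → ℂ} {p : ℝ × ℝ}

theorem IsSolution.mono (hu : IsSolution n O₁ u) (h : O ⊆ O₁) : IsSolution n O u :=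
  ⟨hu.smooth.mono h, fun p hp => hu.mem p (h hp), fun p hp => hu.eqn p (h hp)⟩

theorem IsSolution.cycConj_eq (hu : IsSolution n O u) : ∀ p ∈ O, cycConj n (u p) = u p :=
  fun p hp => mem_eigSpace_zero_iff.1 (hu.mem p hp).1

theorem dt_transform_mul_aMat (hO : IsOpen O) (hu : ContDiffOn ℝ ∞ u O) (hY : ContDiffOn ℝ ∞ Y O)
    (hp : p ∈ O) :
    dt (transform u Y) p * aMat n = aMat n * dt u p + (dt Y p * aMat n - aMat n * dt Y p) := by
  have hlhs := (hasDerivAt_dt hO (contDiffOn_transform hu hY) hp).mul_const (aMat n)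
  simp only [transform_mul_aMat] at hlhs
  have hY' := hasDerivAt_dt hO hY hp
  exact hlhs.unique (((hasDerivAt_dt hO hu hp).const_mul (aMat n)).add
    ((hY'.mul_const (aMat n)).sub (hY'.const_mul (aMat n))))

namespace IsBacklundSolution

variable [NeZero n]

theorem transform_mem (hu : IsSolution n O u) (hY : IsBacklundSolution n O u Y) (hp : p ∈ O) :
    transform u Y p ∈ eigSpace n 0 ∩ slPerp n := by
  have hτY : cycConj n (Y p) = Y p := by rw [← tau_inv_mul_mul_tau, hY.reality p hp]
  have hdiag := mem_slPerp_iff.1 (hu.mem p hp).2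
  refine ⟨mem_eigSpace_zero_iff.2 ?_, mem_slPerp_iff.2 fun i => ?_⟩
  · have h := congrArg (cycConj n) (transform_mul_aMat (u := u) (Y := Y) (p := p))
    simp only [map_add, map_sub, map_mul, cycConj_aMat, hu.cycConj_eq p hp, hτY, Matrix.smul_mul,
      Matrix.mul_smul, ← smul_sub, ← smul_add] at h
    exact ((Matrix.isUnit_iff_isUnit_det _).2 isUnit_det_aMat).mul_right_cancel <|
      (smul_right_injective _ root_ne_zero h).trans transform_mul_aMat.symm
  · have h := congrFun (congrFun (transform_mul_aMat (u := u) (Y := Y) (p := p)) i) i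
    rw [Matrix.add_apply, Matrix.sub_apply, aMat, Matrix.mul_diagonal, Matrix.mul_diagonal,
      Matrix.diagonal_mul, Matrix.diagonal_mul, mul_comm (Y p i i), sub_self, hdiag, mul_zero,
      add_zero] at h
    exact (mul_eq_zero.1 h).resolve_right (pow_ne_zero _ root_ne_zero)

theorem isSolution_transform (hO : IsOpen O) (hu : IsSolution n O u)
    (hY : IsBacklundSolution n O u Y) : IsSolution n O (transform u Y) where
  smooth := contDiffOn_transform hu.smooth hY.smooth
  mem _ hp := hY.transform_mem hu hp
  eqn p hp := by
    have hũ : ContDiffOn ℝ ∞ (transform u Y) O := contDiffOn_transform hu.smooth hY.smooth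
    have hrel := Q_transform_relation hO hu.smooth hY.smooth hY.eqn_x hp (n + 1)
    refine ((Matrix.isUnit_iff_isUnit_det _).2 isUnit_det_aMat).mul_right_cancel ?_
    rw [dt_transform_mul_aMat hO hu.smooth hY.smooth hp, hu.eqn p hp, hY.eqn_t p hp,
      Q_recursion hO hu.smooth hp, Q_recursion hO hũ hp,
      sub_mul (Q (transform u Y) (n + 1 + 1) p * aMat n),
      mul_assoc (aMat n) (Q (transform u Y) (n + 1 + 1) p), eq_sub_of_add_eq hrel]
    noncomm_ring

end IsBacklundSolution

/-- The vector function `ṽ = E(x, t, k)⁻¹ v`. -/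
noncomputable def dressedVec (E : ℝ × ℝ → ℂ → Mat n) (k : ℂ) (v : Fin n → ℂ) (p : ℝ × ℝ) :
    Fin n → ℂ := (E p k)⁻¹ *ᵥ v

/-- The set `𝒪` of the points of `O₁` at which `B(ṽ)` is nonsingular. -/
def dressedDomain (O₁ : Set (ℝ × ℝ)) (E : ℝ × ℝ → ℂ → Mat n) (k : ℂ) (v : Fin n → ℂ) :
    Set (ℝ × ℝ) := {p | p ∈ O₁ ∧ IsUnit (B (dressedVec E k v p)).det}

/-- The matrix function `Ỹ = -k a B(ṽ) a B(ṽ)⁻¹`. -/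
noncomputable def dressedY (E : ℝ × ℝ → ℂ → Mat n) (k : ℂ) (v : Fin n → ℂ) (p : ℝ × ℝ) : Mat n :=
  Ymat (dressedVec E k v p) k

theorem dressedDomain_subset : dressedDomain O₁ E k v ⊆ O₁ := fun _ hp => hp.1

theorem dressedVec_zero (hE : IsTrivialization n O₁ u E) : dressedVec E k v (0, 0) = v := by
  rw [dressedVec, hE.normalized, inv_one, Matrix.one_mulVec]

theorem mulVec_dressedVec (h : IsUnit (E p k).det) : E p k *ᵥ dressedVec E k v p = v := by
  rw [dressedVec, Matrix.mulVec_mulVec, Matrix.mul_nonsing_inv _ h, Matrix.one_mulVec]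

theorem zero_mem_dressedDomain (hE : IsTrivialization n O₁ u E) (h0 : (0, 0) ∈ O₁)
    (hv : IsUnit (B v).det) : (0, 0) ∈ dressedDomain O₁ E k v :=
  ⟨h0, by rwa [dressedVec_zero hE]⟩

theorem contDiffOn_B_dressedVec (hE : IsTrivialization n O₁ u E)
    (hdet : ∀ p ∈ O₁, IsUnit (E p k).det) : ContDiffOn ℝ ∞ (fun p => B (dressedVec E k v p)) O₁ :=
  contDiffOn_bOrbit (contDiffOn_mat_inv (hE.smooth k) hdet) v

theorem isOpen_dressedDomain (hO : IsOpen O₁) (hE : IsTrivialization n O₁ u E)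
    (hdet : ∀ p ∈ O₁, IsUnit (E p k).det) : IsOpen (dressedDomain O₁ E k v) := by
  have hc : ContinuousOn (fun p => (B (dressedVec E k v p)).det) O₁ :=
    (Continuous.matrix_det continuous_id).comp_continuousOn
      (contDiffOn_B_dressedVec hE hdet).continuousOn
  convert hc.isOpen_inter_preimage hO (t := {z : ℂ | z ≠ 0}) isOpen_ne using 1
  ext p
  simp [dressedDomain, isUnit_iff_ne_zero]

theorem contDiffOn_dressedY (hE : IsTrivialization n O₁ u E)
    (hdet : ∀ p ∈ O₁, IsUnit (E p k).det) :
    ContDiffOn ℝ ∞ (dressedY E k v) (dressedDomain O₁ E k v) := by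
  have hB := (contDiffOn_B_dressedVec (v := v) hE hdet).mono
    (dressedDomain_subset (O₁ := O₁) (E := E) (k := k) (v := v))
  exact (((contDiffOn_const.mul hB).mul contDiffOn_const).mul
    (contDiffOn_mat_inv hB fun p hp => hp.2)).const_smul k |>.neg

variable [NeZero n]

theorem dx_dressedY (hO : IsOpen O₁) (hτ : ∀ p ∈ O₁, cycConj n (u p) = u p)
    (hE : IsTrivialization n O₁ u E) (hdet : ∀ p ∈ O₁, IsUnit (E p k).det)
    (hp : p ∈ dressedDomain O₁ E k v) :
    dx (dressedY E k v) p =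
      dressedY E k v p * u p - transform u (dressedY E k v) p * dressedY E k v p := by
  have hEx := hasDerivAt_dx hO (hE.smooth k) hp.1
  rw [hE.eqn_x k p hp.1] at hEx
  refine (hasDerivAt_Ymat (f := fun s => E (s, p.2) k) (s := p.1) (N := 1)
    (q := fun j => if j = 0 then aMat n else u p)
    (qt := fun j => if j = 0 then aMat n else transform u (dressedY E k v) p)
    ?_ (hdet p hp.1) rfl hp.2 ?_ rfl rfl ?_).deriv
  · simpa [Finset.sum_range_succ] using hEx
  · intro j hj
    interval_cases j
    · simpa using cycConj_aMat
    · simpa using hτ p hp.1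
  · intro j hj
    obtain rfl := Nat.lt_one_iff.1 hj
    have h := transform_mul_aMat (u := u) (Y := dressedY E k v) (p := p)
    change transform u (dressedY E k v) p * aMat n + aMat n * dressedY E k v p =
      aMat n * u p + dressedY E k v p * aMat n
    rw [h, add_assoc, sub_add_cancel]

theorem dt_dressedY (hO : IsOpen O₁) (hu : ContDiffOn ℝ ∞ u O₁)
    (hτ : ∀ p ∈ O₁, cycConj n (u p) = u p)
    (hE : IsTrivialization n O₁ u E) (hdet : ∀ p ∈ O₁, IsUnit (E p k).det)
    (hp : p ∈ dressedDomain O₁ E k v) :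
    dt (dressedY E k v) p = dressedY E k v p * Q u (n + 1) p -
      Q (transform u (dressedY E k v)) (n + 1) p * dressedY E k v p := by
  have hroot : root n ^ (n + 1) = root n := by rw [pow_succ, root_pow_self, one_mul]
  have hEt := hasDerivAt_dt hO (hE.smooth k) hp.1
  rw [hE.eqn_t k p hp.1] at hEt
  exact (hasDerivAt_Ymat (f := fun s => E (p.1, s) k) (s := p.2) (q := fun j => Q u j p)
    (qt := fun j => Q (transform u (dressedY E k v)) j p) hEt (hdet p hp.1) rfl hp.2
    (fun j hj => cycConj_Q hO hu hτ hj hroot hp.1) Q_zero Q_zero fun j _ =>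
      Q_transform_relation (isOpen_dressedDomain hO hE hdet) (hu.mono dressedDomain_subset)
        (contDiffOn_dressedY hE hdet) (fun q hq => dx_dressedY hO hτ hE hdet hq) hp j).deriv

theorem isBacklundSolution_dressedY (hO : IsOpen O₁) (hu : ContDiffOn ℝ ∞ u O₁)
    (hτ : ∀ p ∈ O₁, cycConj n (u p) = u p)
    (hE : IsTrivialization n O₁ u E) (hdet : ∀ p ∈ O₁, IsUnit (E p k).det) :
    IsBacklundSolution n (dressedDomain O₁ E k v) u (dressedY E k v) where
  smooth := contDiffOn_dressedY hE hdet
  eqn_x _ hp := dx_dressedY hO hτ hE hdet hp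
  eqn_t _ hp := dt_dressedY hO hu hτ hE hdet hp
  reality _ hp := by rw [tau_inv_mul_mul_tau, dressedY, cycConj_Ymat hp.2]

end Backlund

section Dressing

attribute [local instance] Matrix.linftyOpNormedRing Matrix.linftyOpNormedAlgebra

open Topology

variable {n : ℕ} {v w : Fin n → ℂ} {k z : ℂ}

theorem pMat_eq : pMat w k z = aMat n * (z • (1 : Mat n) - poleMat w k) := by
  rw [pMat, Ymat_eq, mul_sub, Matrix.mul_smul, Matrix.mul_one, sub_eq_add_neg]

theorem sub_poleMat_mul_B (hw : IsUnit (B w).det) :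
    (z • (1 : Mat n) - poleMat w k) * B w =
      B w * diagonal fun j : Fin n => z - root n ^ (j : ℕ) * k := by
  rw [sub_mul, poleMat_mul_B hw]
  ext i j
  rw [Matrix.mul_diagonal, Matrix.sub_apply, Matrix.smul_mul, Matrix.one_mul, Matrix.smul_apply,
    Matrix.smul_apply, aMat, Matrix.mul_diagonal]
  simp only [smul_eq_mul]
  ring

theorem B_inv_mul_sub_poleMat (hw : IsUnit (B w).det) :
    (B w)⁻¹ * (z • (1 : Mat n) - poleMat w k) =
      diagonal (fun j : Fin n => z - root n ^ (j : ℕ) * k) * (B w)⁻¹ := by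
  rw [← Matrix.mul_nonsing_inv_cancel_right (B w) (_ - _) hw, sub_poleMat_mul_B hw,
    Matrix.mul_assoc, Matrix.nonsing_inv_mul_cancel_left _ _ hw]

theorem det_pMat (hw : IsUnit (B w).det) :
    (pMat w k z).det = (aMat n).det * ∏ j : Fin n, (z - root n ^ (j : ℕ) * k) := by
  have h := congrArg Matrix.det (sub_poleMat_mul_B (k := k) (z := z) hw)
  rw [Matrix.det_mul, Matrix.det_mul, mul_comm] at h
  rw [pMat_eq, Matrix.det_mul, hw.mul_left_cancel h, Matrix.det_diagonal]

theorem isUnit_det_pMat [NeZero n] (hw : IsUnit (B w).det) (hz : z ^ n ≠ k ^ n) :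
    IsUnit (pMat w k z).det := by
  rw [det_pMat hw]
  refine isUnit_det_aMat.mul (isUnit_iff_ne_zero.2 (Finset.prod_ne_zero_iff.2 fun j _ h => hz ?_))
  rw [sub_eq_zero.1 h, mul_pow, pow_right_comm, root_pow_self, one_pow, one_mul]

theorem dense_pow_ne [NeZero n] (c : ℂ) : Dense {z : ℂ | z ^ n ≠ c} := by
  have hfin : {z : ℂ | z ^ n = c}.Finite :=
    (Polynomial.nthRoots n c).toFinset.finite_toSet.subset fun z hz => by
      simpa [Polynomial.mem_nthRoots (NeZero.pos n)] using hz
  exact hfin.countable.dense_compl ℂ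

/-- The function `z ↦ (z - k B(v) a B(v)⁻¹) F(z) B(w)`. -/
noncomputable def dressingNum (F : ℂ → Mat n) (k : ℂ) (v w : Fin n → ℂ) (z : ℂ) : Mat n :=
  (z • (1 : Mat n) - poleMat v k) * F z * B w

/-- The dressing `p_{v,k}(z) F(z) p_{w,k}(z)⁻¹` of `F`, extended over the zeros of
`det p_{w,k}(z)`: `p_{w,k}(z)⁻¹` divides the `j`-th column of `dressingNum F k v w z` by
`z - α ^ j k`, and the divided difference `dslope` is this quotient where that column vanishes at
`α ^ j k`. -/
noncomputable def dressing (F : ℂ → Mat n) (k : ℂ) (v w : Fin n → ℂ) (z : ℂ) : Mat n :=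
  aMat n * (Matrix.of fun i j : Fin n =>
    dslope (fun x => dressingNum F k v w x i j) (root n ^ (j : ℕ) * k) z) * (B w)⁻¹ * (aMat n)⁻¹

variable {F : ℂ → Mat n}

theorem differentiable_dressing (hF : Differentiable ℂ F) :
    Differentiable ℂ (dressing F k v w) := by
  have hnum : Differentiable ℂ (dressingNum F k v w) :=
    (((differentiable_id.smul_const (1 : Mat n)).sub_const _).mul hF).mul_const _
  refine Differentiable.mul_const (Differentiable.mul_const (Differentiable.const_mul
    (differentiable_pi.2 fun i => differentiable_pi.2 fun j => ?_) _) _) _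
  have hentry : Differentiable ℂ fun z => dressingNum F k v w z i j :=
    differentiable_pi.1 (differentiable_pi.1 hnum i) j
  simpa only [Matrix.of_apply, differentiableOn_univ] using
    (Complex.differentiableOn_dslope Filter.univ_mem).2 hentry.differentiableOn

variable [NeZero n]

theorem dressingNum_apply_root (hv : IsUnit (B v).det) (hFw : F k *ᵥ w = v)
    (hF : ∀ j, F (root n ^ j * k) = (cycConj n)^[j] (F k)) (i j : Fin n) :
    dressingNum F k v w (root n ^ (j : ℕ) * k) i j = 0 := by
  have hcol : ∀ l, (F (root n ^ (j : ℕ) * k) * B w) l j = B v l j := fun l => by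
    rw [hF, cycConj_iterate_mul_B_apply, hFw]
  rw [dressingNum, Matrix.mul_assoc, Matrix.mul_apply]
  simp only [hcol]
  rw [← Matrix.mul_apply, sub_poleMat_mul_B hv, Matrix.mul_diagonal, sub_self, mul_zero]

theorem dressing_mul_pMat (hv : IsUnit (B v).det) (hw : IsUnit (B w).det) (hFw : F k *ᵥ w = v)
    (hF : ∀ j, F (root n ^ j * k) = (cycConj n)^[j] (F k)) (z : ℂ) :
    dressing F k v w z * pMat w k z = pMat v k z * F z := by
  have hdiv : (Matrix.of fun i j : Fin n =>
      dslope (fun x => dressingNum F k v w x i j) (root n ^ (j : ℕ) * k) z) *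
      (diagonal fun j : Fin n => z - root n ^ (j : ℕ) * k) = dressingNum F k v w z := by
    ext i j
    rw [Matrix.mul_diagonal, Matrix.of_apply, mul_comm, ← smul_eq_mul, sub_smul_dslope,
      dressingNum_apply_root hv hFw hF, sub_zero]
  rw [pMat_eq, dressing, ← Matrix.mul_assoc,
    Matrix.nonsing_inv_mul_cancel_right _ _ isUnit_det_aMat, Matrix.mul_assoc,
    B_inv_mul_sub_poleMat hw, Matrix.mul_assoc, ← Matrix.mul_assoc _ _ (B w)⁻¹, hdiv, dressingNum,
    Matrix.mul_nonsing_inv_cancel_right _ _ hw, ← Matrix.mul_assoc, ← pMat_eq]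

theorem dressing_eq (hv : IsUnit (B v).det) (hw : IsUnit (B w).det) (hFw : F k *ᵥ w = v)
    (hF : ∀ j, F (root n ^ j * k) = (cycConj n)^[j] (F k)) (hz : z ^ n ≠ k ^ n) :
    dressing F k v w z = pMat v k z * F z * (pMat w k z)⁻¹ := by
  rw [← dressing_mul_pMat hv hw hFw hF,
    Matrix.mul_nonsing_inv_cancel_right _ _ (isUnit_det_pMat hw hz)]

theorem det_dressing (hv : IsUnit (B v).det) (hw : IsUnit (B w).det) (hFw : F k *ᵥ w = v)
    (hF : ∀ j, F (root n ^ j * k) = (cycConj n)^[j] (F k)) (hFd : Differentiable ℂ F) (z : ℂ) :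
    (dressing F k v w z).det = (F z).det := by
  have hdet : Continuous (Matrix.det : Mat n → ℂ) := Continuous.matrix_det continuous_id
  refine congrFun (Continuous.ext_on (dense_pow_ne (n := n) (k ^ n))
    (hdet.comp (differentiable_dressing hFd).continuous) (hdet.comp hFd.continuous)
    fun z hz => ?_) z
  have h := congrArg Matrix.det (dressing_mul_pMat hv hw hFw hF z)
  rw [Matrix.det_mul, Matrix.det_mul, det_pMat hv, ← det_pMat hw, mul_comm] at h
  exact (isUnit_det_pMat hw hz).mul_left_cancel h

end Dressing

section DressedTrivialization

attribute [local instance] Matrix.linftyOpNormedRing Matrix.linftyOpNormedAlgebra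

open Set Filter Topology

variable {n : ℕ}

theorem laxSum_gauge {P R : Type*} [NormedRing R] [NormedAlgebra ℂ R] {a Y : R} {q qt : ℕ → P → R}
    {N : ℕ} {p : P} (z : ℂ) (h0 : q 0 p = a) (ht0 : qt 0 p = a)
    (hrel : ∀ j < N, qt (j + 1) p * a + qt j p * Y = a * q (j + 1) p + Y * q j p) :
    Y * q N p - qt N p * Y =
      (z • a + Y) * laxSum q N z p - laxSum qt N z p * (z • a + Y) := by
  have h := gauge_telescope (q := fun j => q j p) (qt := fun j => qt j p) (z • 1) h0 ht0 hrel
  simp only [smul_pow, one_pow, mul_smul_comm, mul_one, ← smul_mul_assoc, ← Finset.sum_mul] at h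
  rw [eq_sub_iff_add_eq', laxSum, laxSum, add_mul]
  exact h.symm

theorem hasDerivAt_gauge {F P : ℝ → Mat n} {A At : Mat n} {s : ℝ} (C : Mat n)
    (hF : HasDerivAt F (F s * A) s) (hP : HasDerivAt P (P s * A - At * P s) s)
    (hu : IsUnit (P s).det) :
    HasDerivAt (fun r => C * F r * (P r)⁻¹) (C * F s * (P s)⁻¹ * At) s := by
  refine ((hF.const_mul C).mul (hasDerivAt_mat_inv hP hu)).congr_deriv ?_
  have hPinv : (P s)⁻¹ * (P s * A - At * P s) * (P s)⁻¹ = A * (P s)⁻¹ - (P s)⁻¹ * At := by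
    rw [mul_sub, sub_mul, Matrix.nonsing_inv_mul_cancel_left _ _ hu, ← mul_assoc _ At,
      Matrix.mul_nonsing_inv_cancel_right _ _ hu]
  rw [hPinv]
  noncomm_ring

theorem SolvesTotalSystem.gauge [NeZero n] {O : Set (ℝ × ℝ)} {u Y F : ℝ × ℝ → Mat n} {z : ℂ}
    (hO : IsOpen O) (hu : ContDiffOn ℝ ∞ u O) (hY : IsBacklundSolution n O u Y)
    (hF : SolvesTotalSystem (laxForm (aMat n) u (Q u) (n + 1) z) 0 F O)
    (hP : ∀ p ∈ O, IsUnit (z • aMat n + Y p).det) (C : Mat n) :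
    SolvesTotalSystem (laxForm (aMat n) (transform u Y) (Q (transform u Y)) (n + 1) z) 0
      (fun p => C * F p * (z • aMat n + Y p)⁻¹) O := by
  have hFs : ContDiffOn ℝ ∞ F O :=
    hF.contDiffOn hO (contDiffOn_laxForm hu (contDiffOn_Q hO hu) z) contDiffOn_const
  have hs : ContDiffOn ℝ ∞ (fun p => C * F p * (z • aMat n + Y p)⁻¹) O :=
    (contDiffOn_const.mul hFs).mul (contDiffOn_mat_inv (contDiffOn_const.add hY.smooth) hP)
  refine (solvesTotalSystem_laxForm_iff hO hs).2 fun p hp => ?_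
  obtain ⟨hFx, hFt⟩ := (solvesTotalSystem_laxForm_iff hO hFs).1 hF p hp
  have hYx : dx Y p = (z • aMat n + Y p) * (z • aMat n + u p) -
      (z • aMat n + transform u Y p) * (z • aMat n + Y p) := by
    rw [hY.eqn_x p hp]
    simp only [mul_add, add_mul, Matrix.smul_mul, Matrix.mul_smul, transform_mul_aMat, smul_add,
      smul_sub]
    abel
  have hYt : dt Y p = (z • aMat n + Y p) * laxSum (Q u) (n + 1) z p -
      laxSum (Q (transform u Y)) (n + 1) z p * (z • aMat n + Y p) :=
    (hY.eqn_t p hp).trans (laxSum_gauge z Q_zero Q_zero fun j _ =>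
      Q_transform_relation hO hu hY.smooth hY.eqn_x hp j)
  have hFx' := hasDerivAt_dx hO hFs hp
  have hFt' := hasDerivAt_dt hO hFs hp
  have hPx := (hasDerivAt_dx hO hY.smooth hp).const_add (z • aMat n)
  have hPt := (hasDerivAt_dt hO hY.smooth hp).const_add (z • aMat n)
  rw [hFx] at hFx'
  rw [hFt] at hFt'
  rw [hYx] at hPx
  rw [hYt] at hPt
  exact ⟨(hasDerivAt_gauge C hFx' hPx (hP p hp)).deriv,
    (hasDerivAt_gauge C hFt' hPt (hP p hp)).deriv⟩

theorem IsTrivialization.of_solvesTotalSystem {O : Set (ℝ × ℝ)} {u : ℝ × ℝ → Mat n}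
    {E : ℝ × ℝ → ℂ → Mat n} (hO : IsOpen O) (hu : ContDiffOn ℝ ∞ u O)
    (hE : ∀ z, SolvesTotalSystem (laxForm (aMat n) u (Q u) (n + 1) z) 0 (fun p => E p z) O)
    (h0 : ∀ z, E (0, 0) z = 1) : IsTrivialization n O u E := by
  have hs : ∀ z, ContDiffOn ℝ ∞ (fun p => E p z) O := fun z =>
    (hE z).contDiffOn hO (contDiffOn_laxForm hu (contDiffOn_Q hO hu) z) contDiffOn_const
  have hiff := fun z => (solvesTotalSystem_laxForm_iff hO (hs z)).1 (hE z)
  exact ⟨hs, fun z p hp => (hiff z p hp).1, fun z p hp => (hiff z p hp).2, h0⟩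

variable {O₁ : Set (ℝ × ℝ)} {u : ℝ × ℝ → Mat n} {E : ℝ × ℝ → ℂ → Mat n} {k : ℂ} {v : Fin n → ℂ}

/-- The trivialization `Ẽ(x, t, λ) = p_{v,k}(λ) E(x, t, λ) p_{ṽ,k}(λ)⁻¹`, extended to all `λ`. -/
noncomputable def dressedE (E : ℝ × ℝ → ℂ → Mat n) (k : ℂ) (v : Fin n → ℂ) (p : ℝ × ℝ) :
    ℂ → Mat n := dressing (E p) k v (dressedVec E k v p)

variable [NeZero n]

theorem dressedE_eq (hE : ∀ p ∈ O₁, ∀ j, E p (root n ^ j * k) = (cycConj n)^[j] (E p k))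
    (hdet : ∀ p ∈ O₁, IsUnit (E p k).det) (hv : IsUnit (B v).det) {p : ℝ × ℝ}
    (hp : p ∈ dressedDomain O₁ E k v) {z : ℂ} (hz : z ^ n ≠ k ^ n) :
    dressedE E k v p z = pMat v k z * E p z * (pMat (dressedVec E k v p) k z)⁻¹ :=
  dressing_eq hv hp.2 (mulVec_dressedVec (hdet p hp.1)) (hE p hp.1) hz

theorem solvesTotalSystem_dressedE (hO : IsOpen O₁) (hu : IsSolution n O₁ u)
    (hE : IsTrivialization n O₁ u E)
    (hdiff : ∀ p ∈ O₁, Differentiable ℂ (E p)) (hdet : ∀ p ∈ O₁, IsUnit (E p k).det)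
    (hsymm : ∀ p ∈ O₁, ∀ j, E p (root n ^ j * k) = (cycConj n)^[j] (E p k))
    (hv : IsUnit (B v).det) (z : ℂ) :
    SolvesTotalSystem (laxForm (aMat n) (transform u (dressedY E k v))
      (Q (transform u (dressedY E k v))) (n + 1) z) 0 (fun p => dressedE E k v p z)
      (dressedDomain O₁ E k v) := by
  have hO' := isOpen_dressedDomain (v := v) hO hE hdet
  have hu' := hu.smooth.mono (dressedDomain_subset (E := E) (k := k) (v := v))
  have hY := isBacklundSolution_dressedY (v := v) hO hu.smooth hu.cycConj_eq hE hdet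
  have hut := contDiffOn_transform hu' hY.smooth
  have hgeneric : ∀ z : ℂ, z ^ n ≠ k ^ n → SolvesTotalSystem
      (laxForm (aMat n) (transform u (dressedY E k v)) (Q (transform u (dressedY E k v)))
        (n + 1) z) 0 (fun p => dressedE E k v p z) (dressedDomain O₁ E k v) := fun z hz =>
    (((hE.solvesTotalSystem hO z).mono dressedDomain_subset).gauge hO' hu' hY
      (fun p hp => isUnit_det_pMat hp.2 hz) (pMat v k z)).congr hO' fun p hp =>
        dressedE_eq hsymm hdet hv hp hz
  have : (𝓝[{z : ℂ | z ^ n ≠ k ^ n}] z).NeBot :=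
    mem_closure_iff_nhdsWithin_neBot.1 (dense_pow_ne (k ^ n) z)
  exact SolvesTotalSystem.of_tendsto (g := 0) (l := 𝓝[{z : ℂ | z ^ n ≠ k ^ n}] z)
    nhdsWithin_le_nhds hO'
    (continuousOn_laxForm hut.continuousOn fun j => (contDiffOn_Q hO' hut j).continuousOn)
    continuousOn_const (eventually_nhdsWithin_of_forall hgeneric) fun p hp =>
      (differentiable_dressing (hdiff p hp.1)).continuous.continuousWithinAt

theorem dressedE_zero (hE : IsTrivialization n O₁ u E) (h0 : (0, 0) ∈ O₁)
    (hdiff : ∀ p ∈ O₁, Differentiable ℂ (E p))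
    (hsymm : ∀ p ∈ O₁, ∀ j, E p (root n ^ j * k) = (cycConj n)^[j] (E p k))
    (hdet : ∀ p ∈ O₁, IsUnit (E p k).det) (hv : IsUnit (B v).det) (z : ℂ) :
    dressedE E k v (0, 0) z = 1 := by
  refine congrFun (Continuous.ext_on (dense_pow_ne (n := n) (k ^ n))
    (differentiable_dressing (hdiff _ h0)).continuous continuous_const fun z hz => ?_) z
  rw [← dressedE, dressedE_eq hsymm hdet hv (zero_mem_dressedDomain hE h0 hv) hz,
    dressedVec_zero hE, hE.normalized, mul_one, Matrix.mul_nonsing_inv _ (isUnit_det_pMat hv hz)]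

theorem isTrivialization_dressedE (hO : IsOpen O₁) (hu : IsSolution n O₁ u)
    (hE : IsTrivialization n O₁ u E) (h0 : (0, 0) ∈ O₁)
    (hdiff : ∀ p ∈ O₁, Differentiable ℂ (E p)) (hdet : ∀ p ∈ O₁, IsUnit (E p k).det)
    (hsymm : ∀ p ∈ O₁, ∀ j, E p (root n ^ j * k) = (cycConj n)^[j] (E p k))
    (hv : IsUnit (B v).det) :
    IsTrivialization n (dressedDomain O₁ E k v) (transform u (dressedY E k v))
      (dressedE E k v) :=
  .of_solvesTotalSystem (isOpen_dressedDomain hO hE hdet)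
    (contDiffOn_transform (hu.smooth.mono dressedDomain_subset) (contDiffOn_dressedY hE hdet))
    (solvesTotalSystem_dressedE hO hu hE hdiff hdet hsymm hv)
    (dressedE_zero hE h0 hdiff hsymm hdet hv)

end DressedTrivialization

end KW

theorem theorem13p12 (n : ℕ) (hn : 2 ≤ n)
    (O₁ : Set (ℝ × ℝ)) (hopen : IsOpen O₁) (hconn : IsPreconnected O₁) (hzero : (0, 0) ∈ O₁)
    (u : ℝ × ℝ → KW.Mat n) (hu : KW.IsSolution n O₁ u)
    (E : ℝ × ℝ → ℂ → KW.Mat n) (hE : KW.IsTrivialization n O₁ u E)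
    (v : Fin n → ℂ) (k : ℂ) (hk : k ≠ 0) (hv : IsUnit (KW.B v).det)
    (vt : ℝ × ℝ → Fin n → ℂ) (hvt : vt = fun p => (E p k)⁻¹ *ᵥ v)
    (O : Set (ℝ × ℝ)) (hO : O = {p | p ∈ O₁ ∧ IsUnit (KW.B (vt p)).det})
    (Yt ut : ℝ × ℝ → KW.Mat n) (hYt : Yt = fun p => KW.Ymat (vt p) k)
    (hut : ut = KW.transform u Yt) :
    (∀ p ∈ O₁, IsUnit (E p k).det) ∧
    IsOpen O ∧ (0, 0) ∈ O ∧
    KW.IsSolution n O ut ∧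
    (∃ Et : ℝ × ℝ → ℂ → KW.Mat n,
      KW.IsTrivialization n O ut Et ∧
      (∀ p ∈ O, Differentiable ℂ (Et p)) ∧
      (∀ p ∈ O, ∀ z : ℂ, IsUnit (Et p z).det) ∧
      (∀ p ∈ O, ∀ z : ℂ, z ^ n ≠ k ^ n →
        Et p z = KW.pMat v k z * E p z * (KW.pMat (vt p) k z)⁻¹)) ∧
    KW.IsBacklundSolution n O u Yt := by
  have : NeZero n := ⟨by omega⟩
  obtain rfl : vt = KW.dressedVec E k v := hvt
  obtain rfl : O = KW.dressedDomain O₁ E k v := hO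
  obtain rfl : Yt = KW.dressedY E k v := hYt
  obtain rfl := hut
  have hdet : ∀ p ∈ O₁, ∀ z, IsUnit (E p z).det := fun p hp =>
    hE.isUnit_det hopen hconn hzero hu.smooth hp
  have hdiff : ∀ p ∈ O₁, Differentiable ℂ (E p) := fun p hp =>
    hE.differentiable hopen hconn hzero hu.smooth hp
  have hsymm : ∀ p ∈ O₁, ∀ j, E p (KW.root n ^ j * k) = (KW.cycConj n)^[j] (E p k) := fun p hp =>
    hE.apply_root_pow_mul hopen hconn hzero hu.smooth hu.cycConj_eq hp k
  have hdetk : ∀ p ∈ O₁, IsUnit (E p k).det := fun p hp => hdet p hp k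
  have hopen' := KW.isOpen_dressedDomain (v := v) hopen hE hdetk
  have hY := KW.isBacklundSolution_dressedY (v := v) hopen hu.smooth hu.cycConj_eq hE hdetk
  refine ⟨hdetk, hopen', KW.zero_mem_dressedDomain hE hzero hv,
    hY.isSolution_transform hopen' (hu.mono KW.dressedDomain_subset),
    ⟨KW.dressedE E k v, KW.isTrivialization_dressedE hopen hu hE hzero hdiff hdetk hsymm hv,
      fun p hp => KW.differentiable_dressing (hdiff p hp.1), fun p hp z => ?_,
      fun p hp z hz => KW.dressedE_eq hsymm hdetk hv hp hz⟩, hY⟩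
  rw [KW.dressedE, KW.det_dressing hv hp.2 (KW.mulVec_dressedVec (hdetk p hp.1)) (hsymm p hp.1)
    (hdiff p hp.1)]
  exact hdet p hp.1 z
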